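/- Let $\lambda>\alpha>0$. Let $(\tau_i)_{i\ge 0}$ be (a measurable enumeration of) the points of a homogeneous Poisson process on $\mathbb{R}$ with intensity $\lambda$, and let $(\beta_i)_{i\ge 0}$ be i.i.d. real random variables, independent of $(\tau_i)$, with $\mathbb{E}|\beta_0|<\infty$. Let $g\in C^\infty(\mathbb{R})\cap L^1(\mathbb{R})$ be such that for every integer $k\ge 1$ there are nonzero real polynomials $c_k, C_k$ with $$g^{(k)}(t)\sim c_k(t)\,e^{\alpha t}\ \text{ as } t\to-\infty,\qquad g^{(k)}(t)\sim C_k(t)\,e^{-\alpha t}\ \text{ as } t\to+\infty,$$ where $\sim$ means that the quotient tends to $1$. Consider the shot noise process $$X(t)=\sum_{i}\beta_i\,g(t-\tau_i),\qquad t\in\mathbb{R}.$$ Assume in addition that either (i) $\beta_0$ has a bounded density with respect to Lebesgue measure; or (ii) $\mathbb{E}(1/|\beta_0|)<\infty$ (with $1/0=\infty$), and at least one of the functions $x\mapsto g(x)$, $x\mapsto g(-x)$ has a strictly negative derivative at every point of $(0,+\infty)$. Then, almost surely, the series defining $X(t)$ converges absolutely for all $t\in\mathbb{R}$ simultaneously;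 and for every bounded interval $I\subset\mathbb{R}$ and every level $u\in\mathbb{R}$, the number of crossings $N_u=\#\{t\in I: X(t)=u\}\in\{0,1,\dots\}\cup\{\infty\}$ is (almost everywhere equal to) a random variable and satisfies $\mathbb{E}(N_u^p)<\infty$ for every real $p\ge 1$. -/

import Mathlib

open MeasureTheory ProbabilityTheory Filter Asymptotics
open scoped ENNReal NNReal

namespace ShotNoise

/-- The number (possibly infinite) of points of the sequence `τ` which lie in the set `A`,
counted with multiplicity. -/
noncomputable def pointCount {Ω : Type*} (τ : ℕ → Ω → ℝ) (A : Set ℝ) (ω : Ω) : ℕ∞ :=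
  Set.encard {i : ℕ | τ i ω ∈ A}

/-- The random points `τ 0, τ 1, …` form (in some measurable enumeration) a homogeneous Poisson
process on the real line with intensity `l`: the number of points in a Borel set `A` of finite
Lebesgue measure is Poisson distributed with mean `l * |A|`, and the numbers of points in pairwise
disjoint Borel sets of finite Lebesgue measure are independent. -/
structure IsPoissonProcess {Ω : Type*} [MeasurableSpace Ω] (τ : ℕ → Ω → ℝ) (l : ℝ)
    (P : Measure Ω) : Prop where
  measurable : ∀ i, Measurable (τ i)
  law_count : ∀ A : Set ℝ, MeasurableSet A → volume A ≠ ∞ →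
    P.map (pointCount τ A) =
      (poissonMeasure (l * volume.real A).toNNReal).map (fun n : ℕ => (n : ℕ∞))
  indep_count : ∀ (n : ℕ) (A : Fin n → Set ℝ), (∀ j, MeasurableSet (A j)) →
    (∀ j, volume (A j) ≠ ∞) → Pairwise (fun i j => Disjoint (A i) (A j)) →
    iIndepFun (fun j => pointCount τ (A j)) P

/-- The impulses `β 0, β 1, …` are independent, identically distributed, and (as a sequence)
independent of the sequence of points `τ`. -/
structure IsImpulses {Ω : Type*} [MeasurableSpace Ω] (β τ : ℕ → Ω → ℝ) (P : Measure Ω) :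
    Prop where
  measurable : ∀ i, Measurable (β i)
  indep : iIndepFun β P
  identDistrib : ∀ i, IdentDistrib (β i) (β 0) P P
  indep_points : IndepFun (fun ω i => β i ω) (fun ω i => τ i ω) P

/-- The shot noise `X(t) = ∑ i, β i * g (t - τ i)`. -/
noncomputable def shotNoise {Ω : Type*} (β τ : ℕ → Ω → ℝ) (g : ℝ → ℝ) (t : ℝ) (ω : Ω) : ℝ :=
  ∑' i, β i ω * g (t - τ i ω)

/-- The number (possibly infinite) of crossings `N_u(I) = #{t ∈ I : X(t) = u}`. -/
noncomputable def crossings {Ω : Type*} (X : ℝ → Ω → ℝ) (I : Set ℝ) (u : ℝ) (ω : Ω) : ℕ∞ :=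
  Set.encard {t : ℝ | t ∈ I ∧ X t ω = u}

/-- The real random variable `Y` has a bounded density with respect to Lebesgue measure. -/
def HasBoundedDensity {Ω : Type*} [MeasurableSpace Ω] (Y : Ω → ℝ) (P : Measure Ω) : Prop :=
  ∃ (f : ℝ → ℝ≥0∞) (B : ℝ≥0), Measurable f ∧ (∀ x, f x ≤ B) ∧
    P.map Y = volume.withDensity f

/-- Every derivative of `g` of order `k ≥ 1` is equivalent to a nonzero polynomial times
`exp (a t)` at `-∞`, and to a nonzero polynomial times `exp (-a t)` at `+∞`. -/
def HasExponentialDerivatives (g : ℝ → ℝ) (a : ℝ) : Prop :=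
  ∀ k : ℕ, 1 ≤ k → ∃ c C : Polynomial ℝ, c ≠ 0 ∧ C ≠ 0 ∧
    (iteratedDeriv k g ~[atBot] fun t => c.eval t * Real.exp (a * t)) ∧
    (iteratedDeriv k g ~[atTop] fun t => C.eval t * Real.exp (-a * t))

end ShotNoise

/-! Many crossings force `X - u` to be tiny at some grid point, and that is unlikely.

If a function has `k` zeros in an interval of length `d` on which its `k`-th derivative is at most
`M`, Rolle's theorem bounds it by `M * d ^ k` there (`abs_le_of_card_zeros`). On a grid of `[-T, T]`
with mesh `d = 2T/n`, more than `(n + 1) * k` crossings put at least `k` of them in one cell, so `|X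
- u| ≤ M * d ^ k` at a grid point (`encard_zeros_le`). All derivatives of `g` are `O(exp
(-(α/2)|t|))`, so `M` is at most a constant times the single variable `G = ∑ |β i| exp (-(α/2)|τ
i|)`, whose mean is finite by Campbell's formula. By Markov, `G ≥ n ^ s` has probability `O(n ^
(-s))`. If moreover `P(|X(t) - u| ≤ ε) ≤ C ε ^ γ` uniformly in `t`, the `n + 1` grid points cost
`O(n ^ (1 + γ (s - k)))`, which is `O(n ^ (-s))` for large `k`. Taking `s = p + 2` makes the `p`-th
moment finite.

The small ball bound comes from decay of the characteristic function of `X(t)`, which is `exp (l ∫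
(φ(s g(x)) - 1) dx)` with `φ` that of `β 0`. Its modulus is `exp (-l ∫ E(1 - cos(s β g(x))) dx)`.
Either alternative in the hypotheses excludes an atom of `β 0` at zero, so `q = P(|β 0| ≥ δ) > 0`
for some `δ > 0`. For `|y| ≥ δ` the phase `s y g(x)` has monotone derivative of size at least `1` on
an interval from a fixed `R` to about `log |s| / α`. There van der Corput's lemma keeps `∫ cos`
below `4`, so the exponent is at most `-l q log |s| / α + O(1)`: polynomial decay, which Gaussian
smoothing turns into the small ball bound. -/

namespace ShotNoise

/-! ### Poisson point processes: Campbell's formula and generating functions -/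

section Poisson

lemma lintegral_natCast_poissonMeasure (r : ℝ≥0) :
    ∫⁻ n : ℕ, (n : ℝ≥0∞) ∂(poissonMeasure r) = r := by
  rw [lintegral_countable']
  simp_rw [poissonMeasure_singleton]
  have h : ∀ n : ℕ, (n : ℝ≥0∞) * ENNReal.ofReal (Real.exp (-r) * r ^ n / n.factorial) =
      ENNReal.ofReal (n * (Real.exp (-r) * r ^ n / n.factorial)) := fun n => by
    rw [ENNReal.ofReal_mul (by positivity), ENNReal.ofReal_natCast]
  simp_rw [h]
  have hs : HasSum (fun n : ℕ => (n : ℝ) * (Real.exp (-r) * r ^ n / n.factorial)) r := by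
    rw [← hasSum_nat_add_iff' 1]
    have := (hasSum_one_poissonMeasure r).mul_left (r : ℝ)
    simp only [mul_one] at this
    simp only [Finset.range_one, Finset.sum_singleton, CharP.cast_eq_zero, zero_mul, sub_zero]
    have e : ∀ n : ℕ, ((n + 1 : ℕ) : ℝ) * (Real.exp (-r) * r ^ (n + 1) / (n + 1).factorial) =
        r * (Real.exp (-r) * r ^ n / n.factorial) := fun n => by
      rw [Nat.factorial_succ]
      have : ((n : ℝ) + 1) ≠ 0 := by positivity
      push_cast
      field_simp
      ring
    simpa only [e] using this
  rw [← ENNReal.ofReal_tsum_of_nonneg (fun n => by positivity) hs.summable, hs.tsum_eq]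
  simp

lemma integral_pow_poissonMeasure (r : ℝ≥0) (z : ℂ) :
    ∫ n : ℕ, z ^ n ∂(poissonMeasure r) = Complex.exp (r * (z - 1)) := by
  rw [integral_poissonMeasure]
  have hs : HasSum (fun n : ℕ => (Real.exp (-r) * r ^ n / n.factorial : ℝ) • z ^ n)
      (Complex.exp (-r) * Complex.exp (r * z)) := by
    have h := (NormedSpace.expSeries_div_hasSum_exp ((r : ℂ) * z)).mul_left (Complex.exp (-r))
    rw [← Complex.exp_eq_exp_ℂ] at h
    have e : ∀ n : ℕ, (Real.exp (-r) * r ^ n / n.factorial : ℝ) • z ^ n =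
        Complex.exp (-r) * ((r * z) ^ n / n.factorial) := fun n => by
      rw [Complex.real_smul]
      push_cast
      ring
    simpa only [e] using h
  rw [hs.tsum_eq, ← Complex.exp_add]
  ring_nf

variable {Ω : Type*} [MeasurableSpace Ω] {P : Measure Ω} {τ β : ℕ → Ω → ℝ} {l : ℝ}

lemma pointCount_toENNReal {Ω : Type*} (τ : ℕ → Ω → ℝ) (A : Set ℝ) (ω : Ω) :
    (pointCount τ A ω : ℝ≥0∞) = ∑' i, A.indicator 1 (τ i ω) := by
  rw [pointCount, ← ENNReal.tsum_set_one, tsum_subtype (f := fun _ => (1 : ℝ≥0∞))]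
  rfl

/-- `Measure.map` along a function that is not a.e. measurable is zero by convention, whereas the
prescribed law has mass one. -/
lemma IsPoissonProcess.aemeasurable_pointCount [IsProbabilityMeasure P]
    (hτ : IsPoissonProcess τ l P) {A : Set ℝ} (hA : MeasurableSet A) (hA' : volume A ≠ ∞) :
    AEMeasurable (pointCount τ A) P := by
  refine AEMeasurable.of_map_ne_zero ?_
  rw [hτ.law_count A hA hA']
  have : IsProbabilityMeasure ((poissonMeasure (l * volume.real A).toNNReal).map
    (fun n : ℕ => (n : ℕ∞))) := Measure.isProbabilityMeasure_map (by fun_prop)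
  exact IsProbabilityMeasure.ne_zero _

lemma IsPoissonProcess.lintegral_pointCount [IsProbabilityMeasure P]
    (hτ : IsPoissonProcess τ l P) {A : Set ℝ} (hA : MeasurableSet A) (hA' : volume A ≠ ∞) :
    ∫⁻ ω, (pointCount τ A ω : ℝ≥0∞) ∂P = ENNReal.ofReal (l * volume.real A) := by
  rw [← lintegral_map' (f := fun n : ℕ∞ => (n : ℝ≥0∞)) (by fun_prop)
    (hτ.aemeasurable_pointCount hA hA'), hτ.law_count A hA hA',
    lintegral_map (by fun_prop) (by fun_prop)]
  simp only [ENat.toENNReal_coe]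
  rw [lintegral_natCast_poissonMeasure]
  rfl

/-- The intensity measure of a Poisson process is a multiple of the Lebesgue measure. -/
lemma IsPoissonProcess.sum_map_eq [IsProbabilityMeasure P]
    (hτ : IsPoissonProcess τ l P) (hl : 0 ≤ l) :
    (Measure.sum fun i => P.map (τ i)) = ENNReal.ofReal l • (volume : Measure ℝ) := by
  have key : ∀ A : Set ℝ, MeasurableSet A → volume A ≠ ∞ →
      (Measure.sum fun i => P.map (τ i)) A = (ENNReal.ofReal l • (volume : Measure ℝ)) A := by
    intro A hA hA'
    have h := hτ.lintegral_pointCount hA hA'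
    simp_rw [pointCount_toENNReal] at h
    have hm : ∀ i, AEMeasurable (fun ω => A.indicator (1 : ℝ → ℝ≥0∞) (τ i ω)) P := fun i =>
      ((measurable_one.indicator hA).comp (hτ.measurable i)).aemeasurable
    rw [lintegral_tsum hm] at h
    rw [Measure.sum_apply _ hA, Measure.smul_apply, smul_eq_mul]
    rw [ENNReal.ofReal_mul hl, Measure.real, ENNReal.ofReal_toReal hA'] at h
    rw [← h]
    congr 1
    funext i
    rw [← lintegral_map (measurable_one.indicator hA) (hτ.measurable i), lintegral_indicator_one hA]
  refine Measure.ext fun A hA => ?_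
  -- The law of the counts only speaks of sets of finite volume; exhaustion by balls reaches the
  -- others.
  have hU : (⋃ n : ℕ, A ∩ Metric.ball 0 (n : ℝ)) = A := by
    rw [← Set.inter_iUnion, Metric.iUnion_ball_nat, Set.inter_univ]
  have hm : Monotone fun n : ℕ => A ∩ Metric.ball (0 : ℝ) n := fun m n hmn =>
    Set.inter_subset_inter_right _ (Metric.ball_subset_ball (by exact_mod_cast hmn))
  rw [← hU, hm.measure_iUnion, hm.measure_iUnion]
  congr 1
  funext n
  exact key _ (hA.inter measurableSet_ball)
    (ne_top_of_le_ne_top measure_ball_lt_top.ne (measure_mono Set.inter_subset_right))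

lemma IsPoissonProcess.tsum_lintegral [IsProbabilityMeasure P]
    (hτ : IsPoissonProcess τ l P) (hl : 0 ≤ l) {f : ℝ → ℝ≥0∞} (hf : Measurable f) :
    ∑' i, ∫⁻ ω, f (τ i ω) ∂P = ENNReal.ofReal l * ∫⁻ x, f x := by
  have h := lintegral_sum_measure f fun i => P.map (τ i)
  rw [hτ.sum_map_eq hl, lintegral_smul_measure, smul_eq_mul] at h
  rw [h]
  congr 1
  funext i
  rw [lintegral_map hf (hτ.measurable i)]

/-- Campbell's formula for the first moment of a marked Poisson process. -/
lemma IsPoissonProcess.lintegral_tsum_impulses [IsProbabilityMeasure P]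
    (hτ : IsPoissonProcess τ l P) (hβ : IsImpulses β τ P) (hl : 0 ≤ l)
    {f : ℝ → ℝ≥0∞} (hf : Measurable f) :
    ∫⁻ ω, ∑' i, ‖β i ω‖ₑ * f (τ i ω) ∂P =
      (∫⁻ ω, ‖β 0 ω‖ₑ ∂P) * (ENNReal.ofReal l * ∫⁻ x, f x) := by
  have hβm := hβ.measurable
  have hτm := hτ.measurable
  have hm : ∀ i, AEMeasurable (fun ω => ‖β i ω‖ₑ * f (τ i ω)) P := fun i =>
    ((hβm i).enorm.mul (hf.comp (hτm i))).aemeasurable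
  rw [lintegral_tsum hm, ← hτ.tsum_lintegral hl hf, ← ENNReal.tsum_mul_left]
  congr 1
  funext i
  have hind : IndepFun (fun ω => ‖β i ω‖ₑ) (fun ω => f (τ i ω)) P :=
    hβ.indep_points.comp (φ := fun b : ℕ → ℝ => ‖b i‖ₑ) (ψ := fun t : ℕ → ℝ => f (t i))
      (by fun_prop) (by fun_prop)
  have h := lintegral_mul_eq_lintegral_mul_lintegral_of_indepFun (hβm i).enorm
    (hf.comp (hτm i)) hind
  have hid := ((hβ.identDistrib i).comp (u := fun x : ℝ => ‖x‖ₑ) measurable_enorm).lintegral_eq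
  simp only [Function.comp_def, Pi.mul_apply] at h hid
  rw [h, hid]

/-- The joint generating function of the numbers of points in disjoint sets. -/
lemma IsPoissonProcess.integral_prod_pow [IsProbabilityMeasure P]
    (hτ : IsPoissonProcess τ l P) {ι : Type*} [Fintype ι] (A : ι → Set ℝ)
    (hA : ∀ j, MeasurableSet (A j)) (hA' : ∀ j, volume (A j) ≠ ∞)
    (hd : Pairwise (fun i j => Disjoint (A i) (A j))) (z : ι → ℂ) :
    ∫ ω, ∏ j, z j ^ (pointCount τ (A j) ω).toNat ∂P =
      Complex.exp (∑ j, ((l * volume.real (A j)).toNNReal : ℂ) * (z j - 1)) := by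
  let e := Fintype.equivFin ι
  have hind : iIndepFun (fun j => pointCount τ (A j)) P := by
    have h := hτ.indep_count _ (fun k => A (e.symm k)) (fun _ => hA _) (fun _ => hA' _)
      (fun i j hij => hd (e.symm.injective.ne hij))
    have := h.precomp e.injective
    simpa using this
  have hind' := hind.comp (fun j n => z j ^ n.toNat) (fun j => by fun_prop)
  simp only [Function.comp_def] at hind'
  have hm : ∀ j, AEStronglyMeasurable (fun ω => z j ^ (pointCount τ (A j) ω).toNat) P := fun j =>
    ((Measurable.of_discrete (f := fun n : ℕ∞ => z j ^ n.toNat)).comp_aemeasurable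
      (hτ.aemeasurable_pointCount (hA j) (hA' j))).aestronglyMeasurable
  rw [hind'.integral_fun_prod_eq_prod_integral hm, Complex.exp_sum]
  refine Finset.prod_congr rfl fun j _ => ?_
  rw [← integral_pow_poissonMeasure, ← integral_map (φ := pointCount τ (A j))
    (f := fun n : ℕ∞ => z j ^ n.toNat) (hτ.aemeasurable_pointCount (hA j) (hA' j))
    (Measurable.of_discrete.aestronglyMeasurable), hτ.law_count _ (hA j) (hA' j),
    integral_map (by fun_prop) (Measurable.of_discrete.aestronglyMeasurable)]
  simp

lemma IsPoissonProcess.ae_finite [IsProbabilityMeasure P]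
    (hτ : IsPoissonProcess τ l P) {A : Set ℝ} (hA : MeasurableSet A) (hA' : volume A ≠ ∞) :
    ∀ᵐ ω ∂P, {i | τ i ω ∈ A}.Finite := by
  have hm := hτ.aemeasurable_pointCount hA hA'
  have h : ∀ᵐ n ∂(P.map (pointCount τ A)), n ≠ ⊤ := by
    rw [hτ.law_count A hA hA', ae_map_iff (by fun_prop) (Set.to_countable _).measurableSet]
    simp
  filter_upwards [ae_of_ae_map hm h] with ω hω
  exact Set.encard_ne_top_iff.mp hω

end Poisson

/-! ### Characteristic functionals of marked Poisson processes -/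

section CharFun

variable {Ω : Type*} [MeasurableSpace Ω] {P : Measure Ω} {τ β : ℕ → Ω → ℝ} {l : ℝ}

lemma norm_cexp_mul_I_sub_le (x y : ℝ) :
    ‖Complex.exp (x * Complex.I) - Complex.exp (y * Complex.I)‖ ≤ |x - y| := by
  have h := Real.norm_exp_I_mul_ofReal_sub_one_le (x := x - y)
  have e : Complex.exp (x * Complex.I) - Complex.exp (y * Complex.I) =
      Complex.exp (y * Complex.I) * (Complex.exp (Complex.I * ((x - y : ℝ) : ℂ)) - 1) := by
    rw [mul_sub, ← Complex.exp_add, mul_one]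
    push_cast
    ring_nf
  rw [e, norm_mul, Complex.norm_exp_ofReal_mul_I, one_mul]
  simpa using h

/-- The Lipschitz constant is the first absolute moment. This makes `φ (s * f x) - 1` integrable
whenever `f` is, and its integral continuous in `f` for the `L¹` norm. -/
lemma norm_charFun_sub_le {ν : Measure ℝ} [IsFiniteMeasure ν] (hν : Integrable (fun x => x) ν)
    (a b : ℝ) : ‖charFun ν a - charFun ν b‖ ≤ |a - b| * ∫ x, |x| ∂ν := by
  have hi : ∀ c : ℝ, Integrable (fun x : ℝ => Complex.exp (c * x * Complex.I)) ν := fun c =>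
    Integrable.of_bound (by fun_prop) 1 (ae_of_all _ fun x => by
      have := Complex.norm_exp_ofReal_mul_I (c * x)
      push_cast at this
      exact this.le)
  rw [charFun_apply_real, charFun_apply_real, ← integral_sub (hi a) (hi b),
    ← integral_const_mul]
  refine norm_integral_le_of_norm_le (hν.abs.const_mul _) (ae_of_all _ fun x => ?_)
  have := norm_cexp_mul_I_sub_le (a * x) (b * x)
  push_cast at this
  refine this.trans_eq ?_
  rw [← sub_mul, abs_mul]

/-- The marks of finitely many points can be integrated out. -/
lemma IsImpulses.integral_cexp_sum_range [IsProbabilityMeasure P] (hβ : IsImpulses β τ P)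
    (hτ : ∀ i, Measurable (τ i)) {f : ℝ → ℝ} (hf : Measurable f) (s : ℝ) (N : ℕ) :
    ∫ ω, Complex.exp ((s * ∑ i ∈ Finset.range N, β i ω * f (τ i ω) : ℝ) * Complex.I) ∂P =
      ∫ ω, ∏ i ∈ Finset.range N, charFun (P.map (β 0)) (s * f (τ i ω)) ∂P := by
  have hβm := hβ.measurable
  let B : Ω → ℕ → ℝ := fun ω i => β i ω
  let T : Ω → ℕ → ℝ := fun ω i => τ i ω
  have hB : Measurable B := by fun_prop
  have hT : Measurable T := by fun_prop
  let F : (ℕ → ℝ) × (ℕ → ℝ) → ℂ := fun q =>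
    Complex.exp ((s * ∑ i ∈ Finset.range N, q.1 i * f (q.2 i) : ℝ) * Complex.I)
  have hF : Measurable F := by fun_prop
  -- The joint law of marks and points is a product, so Fubini allows integrating over the marks
  -- with the points frozen.
  have hprod := (indepFun_iff_map_prod_eq_prod_map_map hB.aemeasurable hT.aemeasurable).mp
    hβ.indep_points
  have : IsProbabilityMeasure (P.map B) := Measure.isProbabilityMeasure_map hB.aemeasurable
  have : IsProbabilityMeasure (P.map T) := Measure.isProbabilityMeasure_map hT.aemeasurable
  have hFi : Integrable F ((P.map B).prod (P.map T)) :=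
    Integrable.of_bound hF.aestronglyMeasurable 1
      (ae_of_all _ fun q => (Complex.norm_exp_ofReal_mul_I _).le)
  have h1 : ∫ ω, F (B ω, T ω) ∂P = ∫ t, ∫ b, F (b, t) ∂(P.map B) ∂(P.map T) := by
    rw [← integral_prod_symm _ hFi, ← hprod,
      integral_map (hB.prodMk hT).aemeasurable hF.aestronglyMeasurable]
  have h2 : ∀ t : ℕ → ℝ, ∫ b, F (b, t) ∂(P.map B) =
      ∏ i ∈ Finset.range N, charFun (P.map (β 0)) (s * f (t i)) := by
    intro t
    rw [integral_map hB.aemeasurable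
      (by fun_prop : Measurable fun b => F (b, t)).aestronglyMeasurable]
    have hind : iIndepFun (fun (i : Finset.range N) ω =>
        Complex.exp ((s * f (t i) * β i ω : ℝ) * Complex.I)) P :=
      (hβ.indep.precomp Subtype.val_injective).comp
        (fun (i : Finset.range N) x => Complex.exp ((s * f (t i) * x : ℝ) * Complex.I))
        (fun i => by fun_prop)
    have h3 := hind.integral_fun_prod_eq_prod_integral
      (fun i => (by fun_prop : Measurable _).aestronglyMeasurable)
    rw [← Finset.prod_coe_sort]
    have h4 : ∀ i : Finset.range N, ∫ ω, Complex.exp ((s * f (t i) * β i ω : ℝ) * Complex.I) ∂P =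
        charFun (P.map (β 0)) (s * f (t i)) := by
      intro i
      rw [← (hβ.identDistrib i).map_eq, charFun_apply_real,
        integral_map (hβm i).aemeasurable (by fun_prop)]
      push_cast
      rfl
    simp_rw [← h4]
    rw [← h3]
    congr 1
    funext ω
    rw [← Complex.exp_sum, ← Finset.sum_mul, ← Complex.ofReal_sum,
      Finset.sum_coe_sort (Finset.range N) (fun i => s * f (t i) * β i ω)]
    simp only [F, B]
    rw [Finset.mul_sum, Finset.sum_congr rfl fun i _ => by rw [mul_comm (β i ω), ← mul_assoc]]
  have hφ : Continuous (charFun (P.map (β 0))) := by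
    have : IsProbabilityMeasure (P.map (β 0)) :=
      Measure.isProbabilityMeasure_map (hβm 0).aemeasurable
    exact continuous_charFun
  have hm : Measurable fun t : ℕ → ℝ =>
      ∏ i ∈ Finset.range N, charFun (P.map (β 0)) (s * f (t i)) :=
    Finset.measurable_fun_prod _ fun i _ => hφ.measurable.comp (by fun_prop)
  calc _ = ∫ ω, F (B ω, T ω) ∂P := rfl
    _ = _ := by
      rw [h1]
      simp_rw [h2]
      rw [integral_map hT.aemeasurable hm.aestronglyMeasurable]

/-- The points are grouped by the value of `h`. Those with value `0` contribute the factor `ψ 0 =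
1`, and `hN` ensures that the finite product sees every other point. -/
lemma prod_range_eq_prod_pow_pointCount {Ω : Type*} (τ : ℕ → Ω → ℝ) (h : SimpleFunc ℝ ℝ)
    (ψ : ℝ → ℂ) (hψ : ψ 0 = 1) (ω : Ω) (N : ℕ) (hN : ∀ i, h (τ i ω) ≠ 0 → i < N) :
    ∏ i ∈ Finset.range N, ψ (h (τ i ω)) =
      ∏ a : {a // a ∈ h.range.filter (· ≠ 0)}, ψ a ^ (pointCount τ (h ⁻¹' {a.1}) ω).toNat := by
  rw [Finset.prod_coe_sort (h.range.filter (· ≠ 0))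
      (fun a => ψ a ^ (pointCount τ (h ⁻¹' {a}) ω).toNat),
    ← Finset.prod_filter_of_ne (p := fun i => h (τ i ω) ≠ 0)
      (fun i _ hi h0 => hi (by rw [h0, hψ])),
    ← Finset.prod_fiberwise_of_maps_to (t := h.range.filter (· ≠ 0)) (g := fun i => h (τ i ω))]
  · refine Finset.prod_congr rfl fun a ha => ?_
    rw [Finset.prod_congr rfl (g := fun _ => ψ a)
      (fun i hi => by rw [(Finset.mem_filter.mp hi).2]), Finset.prod_const]
    congr 1
    rw [pointCount, ← Set.ncard_def, ← Set.ncard_coe_finset]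
    congr 1
    ext i
    have ha0 := (Finset.mem_filter.mp ha).2
    simp only [Finset.coe_filter, Finset.mem_filter, Finset.mem_range, Set.mem_ofPred_eq,
      Set.mem_preimage, Set.mem_singleton_iff]
    exact ⟨fun hi => hi.2, fun hi => ⟨⟨hN i (by rwa [hi]), by rwa [hi]⟩, hi⟩⟩
  · intro i hi
    exact Finset.mem_filter.mpr ⟨h.mem_range_self _, (Finset.mem_filter.mp hi).2⟩

/-- The characteristic function of a simple functional of a marked Poisson process. -/
lemma IsPoissonProcess.integral_cexp_tsum_simpleFunc [IsProbabilityMeasure P]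
    (hτ : IsPoissonProcess τ l P) (hβ : IsImpulses β τ P) (hl : 0 ≤ l)
    (h : SimpleFunc ℝ ℝ) (hh : Integrable h volume) (s : ℝ) :
    ∫ ω, Complex.exp ((s * ∑' i, β i ω * h (τ i ω) : ℝ) * Complex.I) ∂P =
      Complex.exp (l * ∫ x, (charFun (P.map (β 0)) (s * h x) - 1)) := by
  have hβm := hβ.measurable
  have hτm := hτ.measurable
  have hpr : IsProbabilityMeasure (P.map (β 0)) :=
      Measure.isProbabilityMeasure_map (hβm 0).aemeasurable
  set φ := charFun (P.map (β 0))
  have hφ : Continuous φ := continuous_charFun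
  have hφ0 : φ 0 = 1 := by simp [φ]
  have hfin : ∀ᵐ ω ∂P, {i | h (τ i ω) ≠ 0}.Finite := by
    refine hτ.ae_finite (A := Function.support h) h.measurableSet_support ?_
    exact ((SimpleFunc.integrable_iff_finMeasSupp.mp hh)).ne
  have hN : ∀ᵐ ω ∂P, ∃ N, ∀ i, h (τ i ω) ≠ 0 → i < N := by
    filter_upwards [hfin] with ω hω
    obtain ⟨N, hN⟩ := hω.bddAbove
    exact ⟨N + 1, fun i hi => Nat.lt_succ_of_le (hN hi)⟩
  have lim1 : Tendsto (fun N => ∫ ω, Complex.exp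
      ((s * ∑ i ∈ Finset.range N, β i ω * h (τ i ω) : ℝ) * Complex.I) ∂P) atTop
      (nhds (∫ ω, Complex.exp ((s * ∑' i, β i ω * h (τ i ω) : ℝ) * Complex.I) ∂P)) := by
    refine tendsto_integral_of_dominated_convergence (fun _ => 1)
      (fun N => (by fun_prop : Measurable _).aestronglyMeasurable) (integrable_const _)
      (fun N => ae_of_all _ fun ω => (Complex.norm_exp_ofReal_mul_I _).le) ?_
    filter_upwards [hN] with ω ⟨N, hω⟩
    refine tendsto_const_nhds.congr' ?_
    filter_upwards [eventually_ge_atTop N] with M hM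
    rw [tsum_eq_sum (s := Finset.range M)]
    intro i hi
    by_contra h0
    exact hi (Finset.mem_range.mpr ((hω i (right_ne_zero_of_mul h0)).trans_le hM))
  let A : {a // a ∈ h.range.filter (· ≠ 0)} → Set ℝ := fun a => h ⁻¹' {a.1}
  have hA : ∀ a, MeasurableSet (A a) := fun a => h.measurableSet_fiber _
  have hA' : ∀ a, volume (A a) ≠ ∞ := fun a =>
    (SimpleFunc.integrable_iff.mp hh a.1 (Finset.mem_filter.mp a.2).2).ne
  have hd : Pairwise (fun a b => Disjoint (A a) (A b)) := fun a b hab =>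
    (Set.disjoint_singleton.mpr (Subtype.val_injective.ne hab)).preimage _
  have lim2 : Tendsto (fun N => ∫ ω, ∏ i ∈ Finset.range N, φ (s * h (τ i ω)) ∂P) atTop
      (nhds (∫ ω, ∏ a, φ (s * a.1) ^ (pointCount τ (A a) ω).toNat ∂P)) := by
    refine tendsto_integral_of_dominated_convergence (fun _ => 1)
      (fun N => ?_) (integrable_const _) (fun N => ae_of_all _ fun ω => ?_) ?_
    · exact (Finset.measurable_fun_prod _ fun i _ => hφ.measurable.comp
        (by fun_prop)).aestronglyMeasurable
    · rw [norm_prod]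
      exact Finset.prod_le_one (fun _ _ => norm_nonneg _) fun _ _ => norm_charFun_le_one _
    · filter_upwards [hN] with ω ⟨N, hω⟩
      refine tendsto_const_nhds.congr' ?_
      filter_upwards [eventually_ge_atTop N] with M hM
      exact (prod_range_eq_prod_pow_pointCount τ h (fun a => φ (s * a)) (by simp [hφ0]) ω M
        fun i hi => (hω i hi).trans_le hM).symm
  -- Both limits concern the same sequence once the marks are integrated out; the second limit is
  -- the joint generating function of Poisson counts.
  simp_rw [hβ.integral_cexp_sum_range hτm h.measurable s] at lim1
  rw [tendsto_nhds_unique lim1 lim2, hτ.integral_prod_pow A hA hA' hd]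
  congr 1
  -- The value `0` may have a fibre of infinite volume, but `φ 0 - 1 = 0` removes it from the sum.
  have h5 := SimpleFunc.map_integral h (fun a => φ (s * a) - 1) hh (by simp [hφ0])
  rw [SimpleFunc.integral_eq_integral] at h5
  · have h6 : ∫ x, (φ (s * h x) - 1) = ∑ x ∈ h.range, volume.real (h ⁻¹' {x}) • (φ (s * x) - 1) := h5
    rw [h6, Finset.mul_sum, ← Finset.sum_filter_of_ne (s := h.range) (p := (· ≠ 0)),
      ← Finset.sum_coe_sort (h.range.filter (· ≠ 0))]
    · refine Finset.sum_congr rfl fun a _ => ?_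
      rw [Complex.real_smul, ← mul_assoc, ← Complex.ofReal_mul]
      congr 2
      exact Real.coe_toNNReal _ (mul_nonneg hl measureReal_nonneg)
    · rintro x - hx rfl
      simp [hφ0] at hx
  · exact SimpleFunc.integrable_iff_finMeasSupp.mpr
      ((SimpleFunc.integrable_iff_finMeasSupp.mp hh).map (by simp [hφ0]))

lemma IsPoissonProcess.ae_summable_impulses [IsProbabilityMeasure P]
    (hτ : IsPoissonProcess τ l P) (hβ : IsImpulses β τ P) (hl : 0 ≤ l)
    (hβ_int : Integrable (β 0) P) {f : ℝ → ℝ} (hfm : Measurable f) (hf : Integrable f volume) :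
    ∀ᵐ ω ∂P, Summable fun i => β i ω * f (τ i ω) := by
  have hβm := hβ.measurable
  have hτm := hτ.measurable
  have h := hτ.lintegral_tsum_impulses hβ hl (f := fun x => ‖f x‖ₑ) hfm.enorm
  have hlt : ∫⁻ ω, ∑' i, ‖β i ω‖ₑ * ‖f (τ i ω)‖ₑ ∂P ≠ ∞ := by
    rw [h]
    exact ENNReal.mul_ne_top hβ_int.2.ne (ENNReal.mul_ne_top ENNReal.ofReal_ne_top hf.2.ne)
  filter_upwards [ae_lt_top' (by fun_prop) hlt] with ω hω
  refine Summable.of_norm ?_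
  simp_rw [← enorm_mul] at hω
  exact tsum_enorm_ne_top_iff_summable_norm.mp hω.ne

/-- The characteristic function of a linear functional of a marked Poisson process. -/
lemma IsPoissonProcess.integral_cexp_tsum [IsProbabilityMeasure P]
    (hτ : IsPoissonProcess τ l P) (hβ : IsImpulses β τ P) (hl : 0 ≤ l)
    (hβ_int : Integrable (β 0) P) {f : ℝ → ℝ} (hfm : Measurable f) (hf : Integrable f volume)
    (s : ℝ) :
    ∫ ω, Complex.exp ((s * ∑' i, β i ω * f (τ i ω) : ℝ) * Complex.I) ∂P =
      Complex.exp (l * ∫ x, (charFun (P.map (β 0)) (s * f x) - 1)) := by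
  have hβm := hβ.measurable
  have hτm := hτ.measurable
  have hpr : IsProbabilityMeasure (P.map (β 0)) :=
    Measure.isProbabilityMeasure_map (hβm 0).aemeasurable
  have hνi : Integrable (fun x : ℝ => x) (P.map (β 0)) :=
    (integrable_map_measure (by fun_prop) (hβm 0).aemeasurable).mpr hβ_int
  set φ := charFun (P.map (β 0)) with hφdef
  have hφ : Continuous φ := continuous_charFun
  have hφ0 : φ 0 = 1 := by simp [φ]
  have hφi : ∀ k : ℝ → ℝ, Measurable k → Integrable k volume →
      Integrable (fun x => φ (s * k x) - 1) volume := by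
    intro k hkm hk
    refine Integrable.mono' ((hk.const_mul s).abs.mul_const (∫ x, |x| ∂(P.map (β 0))))
      ((hφ.measurable.comp (by fun_prop)).sub_const 1).aestronglyMeasurable (ae_of_all _ fun x => ?_)
    have := norm_charFun_sub_le hνi (s * k x) 0
    simpa [← hφdef, hφ0] using this
  let h : ℕ → SimpleFunc ℝ ℝ := fun n => SimpleFunc.approxOn f hfm Set.univ 0 (Set.mem_univ 0) n
  have hh : ∀ n, Integrable (h n) volume := fun n =>
    SimpleFunc.integrable_approxOn hfm hf (Set.mem_univ 0) (integrable_zero _ _ _) n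
  have hlim : Tendsto (fun n => ∫⁻ x, ‖h n x - f x‖ₑ) atTop (nhds 0) :=
    SimpleFunc.tendsto_approxOn_L1_enorm hfm (Set.mem_univ 0) (by simp) (by simpa using hf.2)
  have lim1 : Tendsto (fun n => ∫ ω, Complex.exp
      ((s * ∑' i, β i ω * h n (τ i ω) : ℝ) * Complex.I) ∂P) atTop
      (nhds (∫ ω, Complex.exp ((s * ∑' i, β i ω * f (τ i ω) : ℝ) * Complex.I) ∂P)) := by
    have hFi : ∀ k : ℝ → ℝ, Measurable k → Integrable (fun ω =>
        Complex.exp ((s * ∑' i, β i ω * k (τ i ω) : ℝ) * Complex.I)) P := fun k hk =>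
      Integrable.of_bound (by fun_prop : Measurable _).aestronglyMeasurable 1
        (ae_of_all _ fun ω => (Complex.norm_exp_ofReal_mul_I _).le)
    refine tendsto_integral_of_L1 _ (hFi f hfm).aestronglyMeasurable
      (Eventually.of_forall fun n => hFi (h n) (h n).measurable) ?_
    -- By Campbell's formula, `L¹` convergence of the kernels on the line gives `L¹` convergence of
    -- the exponentials under `P`.
    have hz : Tendsto (fun n => ‖s‖ₑ * ((∫⁻ ω, ‖β 0 ω‖ₑ ∂P) *
        (ENNReal.ofReal l * ∫⁻ x, ‖h n x - f x‖ₑ))) atTop (nhds 0) := by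
      have h1 := ENNReal.Tendsto.const_mul (a := ENNReal.ofReal l) hlim
        (Or.inr ENNReal.ofReal_ne_top)
      have h2 := ENNReal.Tendsto.const_mul (a := ∫⁻ ω, ‖β 0 ω‖ₑ ∂P) h1 (Or.inr hβ_int.2.ne)
      have h3 := ENNReal.Tendsto.const_mul (a := ‖s‖ₑ) h2 (Or.inr enorm_ne_top)
      simpa using h3
    refine tendsto_of_tendsto_of_tendsto_of_le_of_le tendsto_const_nhds hz
      (fun _ => zero_le) fun n => ?_
    have hc := hτ.lintegral_tsum_impulses hβ hl (f := fun x => ‖h n x - f x‖ₑ)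
      ((h n).measurable.sub hfm).enorm
    dsimp only
    rw [← hc, ← lintegral_const_mul' _ _ enorm_ne_top]
    refine lintegral_mono_ae ?_
    filter_upwards [hτ.ae_summable_impulses hβ hl hβ_int hfm hf,
      hτ.ae_summable_impulses hβ hl hβ_int (h n).measurable (hh n)] with ω h1 h2
    calc ‖Complex.exp ((s * ∑' i, β i ω * h n (τ i ω) : ℝ) * Complex.I) -
          Complex.exp ((s * ∑' i, β i ω * f (τ i ω) : ℝ) * Complex.I)‖ₑ
        ≤ ‖s * ∑' i, β i ω * (h n (τ i ω) - f (τ i ω))‖ₑ := by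
          rw [enorm_le_iff_norm_le]
          refine (norm_cexp_mul_I_sub_le _ _).trans_eq ?_
          rw [← mul_sub, ← h2.tsum_sub h1, Real.norm_eq_abs]
          simp_rw [mul_sub]
      _ ≤ _ := by
          rw [enorm_mul]
          gcongr
          refine (enorm_tsum_le_tsum_enorm).trans_eq ?_
          simp_rw [enorm_mul]
  have lim2 : Tendsto (fun n => ∫ x, (φ (s * h n x) - 1)) atTop
      (nhds (∫ x, (φ (s * f x) - 1))) := by
    refine tendsto_integral_of_L1 _ (hφi f hfm hf).aestronglyMeasurable
      (Eventually.of_forall fun n => hφi (h n) (h n).measurable (hh n)) ?_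
    have hz : Tendsto (fun n => ‖s * ∫ x, |x| ∂(P.map (β 0))‖ₑ * ∫⁻ x, ‖h n x - f x‖ₑ)
        atTop (nhds 0) := by
      simpa using ENNReal.Tendsto.const_mul (a := ‖s * ∫ x, |x| ∂(P.map (β 0))‖ₑ) hlim
        (Or.inr enorm_ne_top)
    refine tendsto_of_tendsto_of_tendsto_of_le_of_le tendsto_const_nhds hz
      (fun _ => zero_le) fun n => ?_
    dsimp only
    rw [← lintegral_const_mul' _ _ enorm_ne_top]
    refine lintegral_mono fun x => ?_
    rw [sub_sub_sub_cancel_right, ← enorm_mul, enorm_le_iff_norm_le]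
    refine (norm_charFun_sub_le hνi _ _).trans_eq ?_
    rw [← mul_sub, norm_mul, norm_mul, abs_mul, Real.norm_eq_abs, Real.norm_eq_abs,
      Real.norm_eq_abs, abs_of_nonneg (a := ∫ x, |x| ∂(P.map (β 0)))
        (integral_nonneg fun _ => abs_nonneg _)]
    ring
  have lim3 := (Complex.continuous_exp.tendsto _).comp (lim2.const_mul (l : ℂ))
  refine tendsto_nhds_unique lim1 (lim3.congr fun n => ?_)
  exact (hτ.integral_cexp_tsum_simpleFunc hβ hl (h n) (hh n) s).symm

end CharFun

/-! ### From characteristic function decay to small ball estimates -/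

section SmallBall

lemma gaussianReal_Icc_le (d : ℝ) (hd : 0 ≤ d) :
    (gaussianReal 0 1).real (Set.Icc (-d) d) ≤ 2 * d := by
  have h : gaussianReal 0 1 (Set.Icc (-d) d) ≤ ENNReal.ofReal (2 * d) := by
    rw [gaussianReal_apply _ one_ne_zero]
    calc ∫⁻ x in Set.Icc (-d) d, gaussianPDF 0 1 x ≤ ∫⁻ x in Set.Icc (-d) d, 1 := by
          refine lintegral_mono fun x => ?_
          rw [gaussianPDF, ← ENNReal.ofReal_one]
          refine ENNReal.ofReal_le_ofReal ?_
          rw [gaussianPDFReal]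
          refine mul_le_one₀ (inv_le_one_of_one_le₀ ?_) (Real.exp_nonneg _) (Real.exp_le_one_iff.mpr ?_)
          · rw [Real.one_le_sqrt]
            simp only [NNReal.coe_one, mul_one]
            linarith [Real.pi_gt_three]
          · have : 0 ≤ (x - 0) ^ 2 / (2 * ((1 : ℝ≥0) : ℝ)) := by positivity
            rw [neg_div]
            linarith
      _ = ENNReal.ofReal (2 * d) := by
          rw [lintegral_one, Measure.restrict_apply_univ, Real.volume_Icc]
          ring_nf
  exact ENNReal.toReal_le_of_le_ofReal (by positivity) h

/-- A probability measure on the line whose characteristic function decays polynomially satisfies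
a small ball estimate, uniformly in the centre of the ball. -/
lemma measureReal_Icc_le_of_norm_charFun_le {ν : Measure ℝ} [IsProbabilityMeasure ν] {C κ : ℝ}
    (hC : 0 ≤ C) (hκ : 0 < κ) (h : ∀ s, s ≠ 0 → ‖charFun ν s‖ ≤ C * |s| ^ (-κ))
    (u ε : ℝ) (hε : 0 < ε) :
    ν.real (Set.Icc (u - ε) (u + ε)) ≤
      Real.exp (1 / 2) * (2 * ε ^ (1 / 2 : ℝ) + C * ε ^ (κ / 2)) := by
  set γ := gaussianReal 0 1
  -- A Gaussian bump of width `ε` is a Gaussian average of characters, so by Fubini its `ν`-integral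
  -- is a Gaussian average of `charFun ν (r / ε)`, up to unimodular factors.
  have hz : ∀ x : ℝ, (Real.exp (-(((x - u) / ε) ^ 2) / 2) : ℂ) =
      ∫ r, Complex.exp ((r * ((x - u) / ε) : ℝ) * Complex.I) ∂γ := by
    intro x
    have h1 := charFun_gaussianReal (μ := 0) (v := 1) ((x - u) / ε)
    rw [charFun_apply_real] at h1
    push_cast at h1 ⊢
    simp_rw [mul_comm (_ : ℂ) (((x : ℂ) - u) / ε)]
    rw [h1]
    congr 1
    ring
  have hint : Integrable (fun q : ℝ × ℝ =>
      Complex.exp ((q.2 * ((q.1 - u) / ε) : ℝ) * Complex.I)) (ν.prod γ) :=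
    Integrable.of_bound (by fun_prop) 1
      (ae_of_all _ fun q => (Complex.norm_exp_ofReal_mul_I _).le)
  have hswap : ∫ x, (Real.exp (-(((x - u) / ε) ^ 2) / 2) : ℂ) ∂ν =
      ∫ r, ∫ x, Complex.exp ((r * ((x - u) / ε) : ℝ) * Complex.I) ∂ν ∂γ := by
    simp_rw [hz]
    exact integral_integral_swap hint
  have hinner : ∀ r : ℝ, ‖∫ x, Complex.exp ((r * ((x - u) / ε) : ℝ) * Complex.I) ∂ν‖ =
      ‖charFun ν (r / ε)‖ := by
    intro r
    have : ∀ x : ℝ, Complex.exp ((r * ((x - u) / ε) : ℝ) * Complex.I) =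
        Complex.exp ((-(r / ε * u) : ℝ) * Complex.I) *
          Complex.exp ((r / ε : ℝ) * x * Complex.I) := by
      intro x
      rw [← Complex.exp_add]
      congr 1
      push_cast
      ring
    simp_rw [this]
    rw [integral_const_mul, norm_mul, Complex.norm_exp_ofReal_mul_I, one_mul, charFun_apply_real]
  -- The frequencies are split at `|r| = ε ^ (1/2)`. Below, the bound `1` is paid for by small
  -- Gaussian mass; above, `|r / ε|` exceeds `ε ^ (-1/2)` and the decay yields `ε ^ (κ / 2)`.
  have hbound : ∀ r : ℝ, ‖charFun ν (r / ε)‖ ≤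
      (Set.Icc (-ε ^ (1 / 2 : ℝ)) (ε ^ (1 / 2 : ℝ))).indicator (fun _ => 1) r + C * ε ^ (κ / 2) := by
    intro r
    by_cases hr : r ∈ Set.Icc (-ε ^ (1 / 2 : ℝ)) (ε ^ (1 / 2 : ℝ))
    · rw [Set.indicator_of_mem hr]
      have := norm_charFun_le_one (μ := ν) (r / ε)
      have : 0 ≤ C * ε ^ (κ / 2) := by positivity
      linarith
    · rw [Set.indicator_of_notMem hr, zero_add]
      rw [Set.mem_Icc, ← abs_le, not_le] at hr
      have hpos : 0 < ε ^ (1 / 2 : ℝ) := by positivity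
      have hr0 : r ≠ 0 := abs_pos.mp (hpos.trans hr)
      refine (h _ (div_ne_zero hr0 hε.ne')).trans (mul_le_mul_of_nonneg_left ?_ hC)
      have h1 : ε ^ (κ / 2) = (ε ^ (-(1 / 2) : ℝ)) ^ (-κ) := by
        rw [← Real.rpow_mul hε.le]
        ring_nf
      rw [h1]
      refine Real.rpow_le_rpow_of_nonpos (by positivity) ?_ (by linarith)
      rw [abs_div, abs_of_pos hε, le_div_iff₀ hε]
      refine le_trans (le_of_eq ?_) hr.le
      nth_rewrite 2 [← Real.rpow_one ε]
      rw [← Real.rpow_add hε]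
      norm_num
  have hexp : ∫ x, Real.exp (-(((x - u) / ε) ^ 2) / 2) ∂ν ≤
      2 * ε ^ (1 / 2 : ℝ) + C * ε ^ (κ / 2) := by
    have h1 : ‖∫ x, (Real.exp (-(((x - u) / ε) ^ 2) / 2) : ℂ) ∂ν‖ =
        ∫ x, Real.exp (-(((x - u) / ε) ^ 2) / 2) ∂ν := by
      rw [integral_complex_ofReal, Complex.norm_real, Real.norm_of_nonneg]
      exact integral_nonneg fun _ => Real.exp_nonneg _
    have hi1 : Integrable
        ((Set.Icc (-ε ^ (1 / 2 : ℝ)) (ε ^ (1 / 2 : ℝ))).indicator (fun _ => (1 : ℝ))) γ :=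
      (integrable_const _).indicator measurableSet_Icc
    rw [← h1, hswap]
    refine (norm_integral_le_of_norm_le (hi1.add (integrable_const (C * ε ^ (κ / 2))))
      (ae_of_all _ fun r => (hinner r).trans_le (hbound r))).trans ?_
    simp only [Pi.add_apply]
    rw [integral_add hi1 (integrable_const _), integral_indicator measurableSet_Icc]
    simp only [integral_const, smul_eq_mul, mul_one, measureReal_restrict_apply_univ,
      probReal_univ, one_mul]
    gcongr
    exact gaussianReal_Icc_le _ (by positivity)
  -- The bump is at least `exp (-1/2)` on the ball, whence the prefactor.
  have hind : ∀ x : ℝ, (Set.Icc (u - ε) (u + ε)).indicator (fun _ => (1 : ℝ)) x ≤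
      Real.exp (1 / 2) * Real.exp (-(((x - u) / ε) ^ 2) / 2) := by
    intro x
    by_cases hx : x ∈ Set.Icc (u - ε) (u + ε)
    · rw [Set.indicator_of_mem hx, ← Real.exp_add]
      refine Real.one_le_exp ?_
      have : ((x - u) / ε) ^ 2 ≤ 1 := by
        rw [sq_le_one_iff_abs_le_one, abs_div, abs_of_pos hε, div_le_one hε, abs_le]
        constructor <;> linarith [hx.1, hx.2]
      linarith
    · rw [Set.indicator_of_notMem hx]
      positivity
  calc ν.real (Set.Icc (u - ε) (u + ε))
      = ∫ x, (Set.Icc (u - ε) (u + ε)).indicator (fun _ => (1 : ℝ)) x ∂ν := by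
        rw [integral_indicator measurableSet_Icc]
        simp
    _ ≤ ∫ x, Real.exp (1 / 2) * Real.exp (-(((x - u) / ε) ^ 2) / 2) ∂ν := by
        refine integral_mono ((integrable_const _).indicator measurableSet_Icc) ?_ hind
        refine Integrable.const_mul ?_ _
        refine Integrable.of_bound (by fun_prop) 1 (ae_of_all _ fun x => ?_)
        rw [Real.norm_of_nonneg (Real.exp_nonneg _), Real.exp_le_one_iff]
        have : 0 ≤ ((x - u) / ε) ^ 2 := by positivity
        linarith
    _ ≤ _ := by
        rw [integral_const_mul]
        gcongr

end SmallBall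

/-! ### Oscillatory integrals -/

section VanDerCorput

/-- The first derivative test of van der Corput. -/
lemma integral_cos_le_of_one_le_abs_deriv {θ θ' θ'' : ℝ → ℝ} (h1 : ∀ x, HasDerivAt θ (θ' x) x)
    (h2 : ∀ x, HasDerivAt θ' (θ'' x) x) {a b : ℝ} (hab : a ≤ b)
    (hθ' : ∀ x ∈ Set.Icc a b, 1 ≤ |θ' x|) (hθ'' : ∀ x ∈ Set.Icc a b, 0 ≤ θ'' x) :
    ∫ x in a..b, Real.cos (θ x) ≤ 4 := by
  have hne : ∀ x ∈ Set.Icc a b, θ' x ≠ 0 := fun x hx => abs_pos.mp (by linarith [hθ' x hx])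
  -- Subtracting `1` from the sine gives a sign: the derivative is `cos θ + (1 - sin θ) θ'' / θ' ^ 2
  -- ≥ cos θ`. The function is bounded by `2`, so its increment is at most `4`.
  have hK : ∀ x ∈ Set.Icc a b, HasDerivAt (fun y => (Real.sin (θ y) - 1) / θ' y)
      ((Real.cos (θ x) * θ' x * θ' x - (Real.sin (θ x) - 1) * θ'' x) / θ' x ^ 2) x :=
    fun x hx => ((h1 x).sin.sub_const 1).div (h2 x) (hne x hx)
  have hθc : Continuous θ := continuous_iff_continuousAt.mpr fun x => (h1 x).continuousAt
  have h := intervalIntegral.integral_le_sub_of_hasDeriv_right_of_le (φ := fun x => Real.cos (θ x))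
    hab (fun x hx => (hK x hx).continuousAt.continuousWithinAt)
    (fun x hx => (hK x (Set.Ioo_subset_Icc_self hx)).hasDerivWithinAt)
    ((Real.continuous_cos.comp hθc).continuousOn.integrableOn_compact isCompact_Icc)
    (fun x hx => by
      have hx' := Set.Ioo_subset_Icc_self hx
      have hp : 0 < θ' x ^ 2 := by have := hne x hx'; positivity
      rw [le_div_iff₀ hp]
      nlinarith [mul_nonneg (sub_nonneg.mpr (Real.sin_le_one (θ x))) (hθ'' x hx')])
  have hb : ∀ x ∈ Set.Icc a b, |(Real.sin (θ x) - 1) / θ' x| ≤ 2 := by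
    intro x hx
    rw [abs_div, div_le_iff₀ (by linarith [hθ' x hx])]
    have : |Real.sin (θ x) - 1| ≤ 2 := abs_le.mpr
      ⟨by linarith [Real.neg_one_le_sin (θ x)], by linarith [Real.sin_le_one (θ x)]⟩
    linarith [hθ' x hx]
  have hb1 := (abs_le.mp (hb a (Set.left_mem_Icc.mpr hab))).1
  have hb2 := (abs_le.mp (hb b (Set.right_mem_Icc.mpr hab))).2
  linarith

lemma sub_four_le_integral_one_sub_cos {g g' g'' : ℝ → ℝ} (h1 : ∀ x, HasDerivAt g (g' x) x)
    (h2 : ∀ x, HasDerivAt g' (g'' x) x) {a b : ℝ} (hab : a ≤ b) (c : ℝ)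
    (hg' : ∀ x ∈ Set.Icc a b, 1 ≤ |c * g' x|)
    (hg'' : (∀ x ∈ Set.Icc a b, 0 ≤ g'' x) ∨ ∀ x ∈ Set.Icc a b, g'' x ≤ 0) :
    b - a - 4 ≤ ∫ x in a..b, (1 - Real.cos (c * g x)) := by
  have hgc : Continuous g := continuous_iff_continuousAt.mpr fun x => (h1 x).continuousAt
  -- The cosine is even, so the sign of `c` may be changed to make the phase convex.
  have key : ∀ d : ℝ, |d| = |c| → (∀ x ∈ Set.Icc a b, 0 ≤ d * g'' x) →
      ∫ x in a..b, Real.cos (c * g x) ≤ 4 := by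
    intro d hd hd'
    have h := integral_cos_le_of_one_le_abs_deriv (fun x => (h1 x).const_mul d)
      (fun x => (h2 x).const_mul d) hab (fun x hx => by
        rw [abs_mul, hd, ← abs_mul]; exact hg' x hx) hd'
    refine le_trans (le_of_eq ?_) h
    congr 1
    funext x
    rw [← Real.cos_abs, abs_mul, ← hd, ← abs_mul, Real.cos_abs]
  have hcos : ∫ x in a..b, Real.cos (c * g x) ≤ 4 := by
    rcases hg'' with h | h
    · exact key |c| (abs_abs c) fun x hx => mul_nonneg (abs_nonneg _) (h x hx)
    · exact key (-|c|) (by simp) fun x hx => mul_nonneg_of_nonpos_of_nonpos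
        (by simp) (h x hx)
  rw [intervalIntegral.integral_sub (by simp) (Continuous.intervalIntegrable (by fun_prop) _ _)]
  simp only [intervalIntegral.integral_const, smul_eq_mul, mul_one]
  linarith

end VanDerCorput

/-! ### Polynomial decay of the characteristic function of the shot noise -/

section Decay

variable {Ω : Type*} [MeasurableSpace Ω] {P : Measure Ω} {τ β : ℕ → Ω → ℝ} {l : ℝ}

/-- The integrand is the `ν`-mean of `1 - cos (s * y * g x) ≥ 0`, so one may keep only `|y| ≥ δ` and
`x ∈ [a, b]`. After Fubini, van der Corput's bound applies for each such `y`, because the phase has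
slope at least `|s| * δ * |g' x| ≥ 1`. -/
lemma mul_sub_four_le_integral_one_sub_re_charFun {ν : Measure ℝ} [IsProbabilityMeasure ν]
    (hν : Integrable (fun x => x) ν)
    {g g' g'' : ℝ → ℝ} (h1 : ∀ x, HasDerivAt g (g' x) x) (h2 : ∀ x, HasDerivAt g' (g'' x) x)
    (hg : Integrable g volume) {a b : ℝ} (hab : a ≤ b) (s δ : ℝ)
    (hg' : ∀ x ∈ Set.Icc a b, 1 ≤ |s| * δ * |g' x|)
    (hg'' : (∀ x ∈ Set.Icc a b, 0 ≤ g'' x) ∨ ∀ x ∈ Set.Icc a b, g'' x ≤ 0) :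
    ν.real {y | δ ≤ |y|} * (b - a - 4) ≤ ∫ x, (1 - (charFun ν (s * g x)).re) := by
  have hgc : Continuous g := continuous_iff_continuousAt.mpr fun x => (h1 x).continuousAt
  have hφ : Continuous (charFun ν) := continuous_charFun
  have hre : ∀ x, 1 - (charFun ν (s * g x)).re = ∫ y, (1 - Real.cos (s * y * g x)) ∂ν := by
    intro x
    have hi : Integrable (fun y : ℝ => Complex.exp ((s * g x : ℝ) * y * Complex.I)) ν :=
      Integrable.of_bound (by fun_prop) 1 (ae_of_all _ fun y => by
        have := Complex.norm_exp_ofReal_mul_I (s * g x * y)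
        push_cast at this ⊢
        exact this.le)
    rw [charFun_apply_real, ← Complex.reCLM_apply, ← ContinuousLinearMap.integral_comp_comm _ hi,
      integral_sub (integrable_const _)]
    · simp only [integral_const, probReal_univ, smul_eq_mul, mul_one]
      congr 2
      funext y
      have := Complex.exp_ofReal_mul_I_re (s * y * g x)
      rw [← this, Complex.reCLM_apply]
      congr 2
      push_cast
      ring
    · exact Integrable.of_bound (by fun_prop) 1 (ae_of_all _ fun y => by
        simpa using Real.abs_cos_le_one _)
  have hnn : ∀ x, 0 ≤ 1 - (charFun ν (s * g x)).re := fun x => by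
    rw [hre]
    exact integral_nonneg fun y => sub_nonneg.mpr (Real.cos_le_one _)
  have hint : Integrable (fun x => 1 - (charFun ν (s * g x)).re) volume := by
    refine Integrable.mono' ((hg.const_mul s).abs.mul_const (∫ x, |x| ∂ν))
      (by fun_prop) (ae_of_all _ fun x => ?_)
    have h := norm_charFun_sub_le hν 0 (s * g x)
    rw [charFun_zero, probReal_univ, zero_sub, abs_neg] at h
    refine le_trans ?_ h
    have := Complex.abs_re_le_norm (1 - charFun ν (s * g x))
    simpa using this
  have hD : MeasurableSet {y : ℝ | δ ≤ |y|} := measurableSet_le measurable_const measurable_abs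
  calc ν.real {y | δ ≤ |y|} * (b - a - 4)
      = ∫ y in {y | δ ≤ |y|}, (b - a - 4) ∂ν := by simp
    _ ≤ ∫ y in {y | δ ≤ |y|}, (∫ x in Set.Ioc a b, (1 - Real.cos (s * y * g x))) ∂ν := by
        refine setIntegral_mono_on (integrable_const _) ?_ hD fun y hy => ?_
        · have : Integrable (fun q : ℝ × ℝ => 1 - Real.cos (s * q.1 * g q.2))
              ((ν.restrict {y | δ ≤ |y|}).prod (volume.restrict (Set.Ioc a b))) :=
            Integrable.of_bound (by fun_prop) 2 (ae_of_all _ fun q => by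
              rw [Real.norm_eq_abs, abs_le]
              constructor <;>
                linarith [Real.cos_le_one (s * q.1 * g q.2), Real.neg_one_le_cos (s * q.1 * g q.2)])
          exact this.integral_prod_left
        · rw [← intervalIntegral.integral_of_le hab]
          refine sub_four_le_integral_one_sub_cos h1 h2 hab _ (fun x hx => ?_) hg''
          refine (hg' x hx).trans ?_
          rw [abs_mul, abs_mul]
          gcongr
          exact hy
    _ = ∫ x in Set.Ioc a b, ∫ y in {y | δ ≤ |y|}, (1 - Real.cos (s * y * g x)) ∂ν := by
        refine integral_integral_swap ?_
        exact Integrable.of_bound (by unfold Function.uncurry; fun_prop) 2 (ae_of_all _ fun q => by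
              rw [Real.norm_eq_abs, abs_le]
              simp only [Function.uncurry]
              constructor <;>
                linarith [Real.cos_le_one (s * q.1 * g q.2), Real.neg_one_le_cos (s * q.1 * g q.2)])
    _ ≤ ∫ x in Set.Ioc a b, (1 - (charFun ν (s * g x)).re) := by
        refine integral_mono_of_nonneg (ae_of_all _ fun x => integral_nonneg fun y =>
          sub_nonneg.mpr (Real.cos_le_one _)) hint.integrableOn (ae_of_all _ fun x => ?_)
        dsimp only
        rw [hre]
        refine setIntegral_le_integral ?_ (ae_of_all _ fun y => sub_nonneg.mpr (Real.cos_le_one _))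
        exact Integrable.of_bound (by fun_prop) 2 (ae_of_all _ fun q => by
              rw [Real.norm_eq_abs, abs_le]
              constructor <;>
                linarith [Real.cos_le_one (s * q * g x), Real.neg_one_le_cos (s * q * g x)])
    _ ≤ _ := setIntegral_le_integral hint (ae_of_all _ hnn)

/-- The characteristic function of the shot noise decays polynomially. -/
lemma norm_charFun_shotNoise_le [IsProbabilityMeasure P]
    (hτ : IsPoissonProcess τ l P) (hβ : IsImpulses β τ P) (hl : 0 ≤ l)
    (hβ_int : Integrable (β 0) P) {g g' g'' : ℝ → ℝ} (h1 : ∀ x, HasDerivAt g (g' x) x)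
    (h2 : ∀ x, HasDerivAt g' (g'' x) x) (hg : Integrable g volume) {R c α δ : ℝ} (hα : 0 < α)
    (hc : 0 < c) (hδ : 0 < δ) (hg' : ∀ x, R ≤ x → c * Real.exp (-α * x) ≤ |g' x|)
    (hg'' : (∀ x, R ≤ x → 0 ≤ g'' x) ∨ ∀ x, R ≤ x → g'' x ≤ 0) (t s : ℝ) (hs : s ≠ 0) :
    ‖charFun (P.map (shotNoise β τ g t)) s‖ ≤
      (Real.exp (l * (P.map (β 0)).real {y | δ ≤ |y|} * (R + 4)) *
        (c * δ) ^ (-(l * (P.map (β 0)).real {y | δ ≤ |y|} / α))) *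
        |s| ^ (-(l * (P.map (β 0)).real {y | δ ≤ |y|} / α)) := by
  have hβm := hβ.measurable
  have hτm := hτ.measurable
  have hgc : Continuous g := continuous_iff_continuousAt.mpr fun x => (h1 x).continuousAt
  have hpr : IsProbabilityMeasure (P.map (β 0)) :=
    Measure.isProbabilityMeasure_map (hβm 0).aemeasurable
  have hνi : Integrable (fun x : ℝ => x) (P.map (β 0)) :=
    (integrable_map_measure (by fun_prop) (hβm 0).aemeasurable).mpr hβ_int
  set ν := P.map (β 0) with hν
  set q := ν.real {y | δ ≤ |y|} with hq
  have hq0 : 0 ≤ q := measureReal_nonneg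
  have hXm : Measurable (shotNoise β τ g t) := by
    unfold shotNoise
    fun_prop
  have hprX : IsProbabilityMeasure (P.map (shotNoise β τ g t)) :=
    Measure.isProbabilityMeasure_map hXm.aemeasurable
  have hs' : 0 < |s| := abs_pos.mpr hs
  -- With `T = log (c * δ * |s|) / α`, the point where `c * δ * |s| * exp (-α * T) = 1`, the claimed
  -- bound is `exp (-l * q * (T - R - 4))`. If `T < R` it exceeds `1` and is trivial.
  have hrhs : (Real.exp (l * q * (R + 4)) * (c * δ) ^ (-(l * q / α))) * |s| ^ (-(l * q / α)) =
      Real.exp (-(l * (q * (Real.log (c * δ * |s|) / α - R - 4)))) := by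
    rw [mul_assoc, ← Real.mul_rpow (by positivity) (by positivity),
      Real.rpow_def_of_pos (by positivity), ← Real.exp_add]
    congr 1
    field_simp
    ring
  rw [hrhs]
  rcases le_or_gt R (Real.log (c * δ * |s|) / α) with hT | hT
  · have hJ := mul_sub_four_le_integral_one_sub_re_charFun hνi h1 h2 hg hT s δ (fun x hx => by
      have h3 := hg' x hx.1
      have h4 : Real.exp (-Real.log (c * δ * |s|)) ≤ Real.exp (-α * x) := by
        refine Real.exp_le_exp.mpr ?_
        have := (le_div_iff₀ hα).mp hx.2
        linarith
      rw [Real.exp_neg, Real.exp_log (by positivity)] at h4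
      calc (1 : ℝ) = |s| * δ * (c * (c * δ * |s|)⁻¹) := by field_simp
        _ ≤ |s| * δ * (c * Real.exp (-α * x)) := by gcongr
        _ ≤ _ := by gcongr)
      (hg''.imp (fun h x hx => h x hx.1) (fun h x hx => h x hx.1))
    have hgt : Integrable (fun x => g (t - x)) volume := hg.comp_sub_left t
    have hcf := hτ.integral_cexp_tsum hβ hl hβ_int (f := fun x => g (t - x)) (by fun_prop) hgt s
    have hchar : charFun (P.map (shotNoise β τ g t)) s =
        Complex.exp (l * ∫ x, (charFun ν (s * g x) - 1)) := by
      rw [charFun_apply_real, integral_map hXm.aemeasurable (by fun_prop)]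
      -- Invariance of Lebesgue measure removes `t`, which makes the decay uniform in time.
      have e := integral_sub_left_eq_self (fun x => charFun ν (s * g x) - 1) volume t
      rw [← e, ← hcf]
      simp only [shotNoise]
      push_cast
      rfl
    have hφ : Continuous (charFun ν) := continuous_charFun
    have hi : Integrable (fun x => charFun ν (s * g x) - 1) volume := by
      refine Integrable.mono' ((hg.const_mul s).abs.mul_const (∫ x, |x| ∂ν))
        (by fun_prop) (ae_of_all _ fun x => ?_)
      have := norm_charFun_sub_le hνi (s * g x) 0
      simpa using this
    rw [hchar, Complex.norm_exp, Complex.re_ofReal_mul]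
    refine Real.exp_le_exp.mpr ?_
    rw [← mul_neg]
    refine mul_le_mul_of_nonneg_left ?_ hl
    have hre : (∫ x, (charFun ν (s * g x) - 1)).re = -∫ x, (1 - (charFun ν (s * g x)).re) := by
      rw [← Complex.reCLM_apply, ← ContinuousLinearMap.integral_comp_comm _ hi, ← integral_neg]
      congr 1
      funext x
      simp
    rw [hre]
    exact neg_le_neg hJ
  · refine (norm_charFun_le_one s).trans (Real.one_le_exp ?_)
    have : l * (q * (Real.log (c * δ * |s|) / α - R - 4)) ≤ 0 :=
      mul_nonpos_of_nonneg_of_nonpos hl (mul_nonpos_of_nonneg_of_nonpos hq0 (by linarith))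
    linarith

end Decay

/-! ### Exponential bounds on the kernel and its derivatives -/

section Kernel

lemma isBigO_eval_mul_exp (C : Polynomial ℝ) {α : ℝ} (hα : 0 < α) :
    (fun t => C.eval t * Real.exp (-α * t)) =O[atTop] fun t => Real.exp (-(α / 2) * t) := by
  have h1 : (fun t => C.eval t) =O[atTop] fun t => Real.exp (α / 2 * t) := by
    have h := Polynomial.isBigO_atTop_of_degree_le C (Polynomial.X ^ C.natDegree)
      (by rw [Polynomial.degree_X_pow]; exact Polynomial.degree_le_natDegree)
    simp only [Polynomial.eval_pow, Polynomial.eval_X] at h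
    exact h.trans (isLittleO_pow_exp_pos_mul_atTop _ (half_pos hα)).isBigO
  have h2 := h1.mul (isBigO_refl (fun t => Real.exp (-α * t)) atTop)
  refine h2.congr_right fun t => ?_
  rw [← Real.exp_add]
  ring_nf

lemma isBigO_exp_eval_mul_exp {C : Polynomial ℝ} (hC : C ≠ 0) (α : ℝ) :
    (fun t => Real.exp (-α * t)) =O[atTop] fun t => C.eval t * Real.exp (-α * t) := by
  have h := Polynomial.isBigO_atTop_of_degree_le (1 : Polynomial ℝ) C
    (by rw [Polynomial.degree_one]; exact Polynomial.zero_le_degree_iff.mpr hC)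
  have h2 := h.mul (isBigO_refl (fun t => Real.exp (-α * t)) atTop)
  refine h2.congr_left fun t => ?_
  simp

lemma exists_forall_abs_le_mul_exp {f : ℝ → ℝ} (hf : Continuous f) {a : ℝ}
    (hT : f =O[atTop] fun t => Real.exp (-a * t))
    (hB : (fun t => f (-t)) =O[atTop] fun t => Real.exp (-a * t)) :
    ∃ K, 0 ≤ K ∧ ∀ x, |f x| ≤ K * Real.exp (-a * |x|) := by
  obtain ⟨c1, -, h1⟩ := hT.exists_pos
  obtain ⟨c2, -, h2⟩ := hB.exists_pos
  obtain ⟨R1, hR1⟩ := eventually_atTop.mp h1.bound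
  obtain ⟨R2, hR2⟩ := eventually_atTop.mp h2.bound
  simp only [Real.norm_eq_abs, Real.abs_exp] at hR1 hR2
  set R := max 0 (max R1 R2)
  have hcont : Continuous fun x => f x * Real.exp (a * |x|) := by fun_prop
  obtain ⟨c3, h3⟩ := (isCompact_Icc (a := -R) (b := R)).exists_bound_of_continuousOn
    hcont.continuousOn
  refine ⟨max 0 (max c1 (max c2 c3)), le_max_left _ _, fun x => ?_⟩
  have hR0 : 0 ≤ R := le_max_left _ _
  have hRR1 : R1 ≤ R := (le_max_left _ _).trans (le_max_right _ _)
  have hRR2 : R2 ≤ R := (le_max_right _ _).trans (le_max_right _ _)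
  have hpos := Real.exp_pos (-a * |x|)
  have key : ∀ c, c ≤ max 0 (max c1 (max c2 c3)) → |f x| ≤ c * Real.exp (-a * |x|) →
      |f x| ≤ max 0 (max c1 (max c2 c3)) * Real.exp (-a * |x|) := fun c hc h =>
    h.trans (mul_le_mul_of_nonneg_right hc hpos.le)
  rcases le_or_gt R x with hx | hx
  · refine key c1 (by simp) ?_
    rw [abs_of_nonneg (hR0.trans hx)]
    exact hR1 x (hRR1.trans hx)
  · rcases le_or_gt x (-R) with hx' | hx'
    · refine key c2 (by simp) ?_
      have := hR2 (-x) (by linarith)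
      rwa [neg_neg, ← abs_of_nonpos (show x ≤ 0 by linarith)] at this
    · refine key c3 (by simp) ?_
      have := h3 x ⟨hx'.le, hx.le⟩
      rw [Real.norm_eq_abs, abs_mul, Real.abs_exp] at this
      rw [neg_mul, Real.exp_neg, ← div_eq_mul_inv, le_div_iff₀ (Real.exp_pos _)]
      exact this

lemma integrable_exp_neg_mul_abs {a : ℝ} (ha : 0 < a) :
    Integrable (fun x : ℝ => Real.exp (-a * |x|)) volume := by
  rw [← integrableOn_univ, ← Set.Iic_union_Ioi (a := (0 : ℝ))]
  refine IntegrableOn.union ?_ ?_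
  · refine (integrableOn_exp_mul_Iic ha 0).congr_fun (fun x hx => ?_) measurableSet_Iic
    simp only [abs_of_nonpos (Set.mem_Iic.mp hx)]
    ring_nf
  · refine (exp_neg_integrableOn_Ioi 0 ha).congr_fun (fun x hx => ?_) measurableSet_Ioi
    simp only [abs_of_pos (Set.mem_Ioi.mp hx)]

/-- The asymptotics concern derivatives of order at least one; this recovers `g`. Since `g` and `g'`
are integrable, `g` vanishes at infinity and is minus the tail integral of `g'`. Negative `x` follow
by reflection. -/
lemma abs_le_of_abs_deriv_le {g g' : ℝ → ℝ} (h : ∀ x, HasDerivAt g (g' x) x)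
    (hg'm : Continuous g') (hg : Integrable g volume) {a K : ℝ} (ha : 0 < a)
    (hg' : ∀ x, |g' x| ≤ K * Real.exp (-a * |x|)) (x : ℝ) :
    |g x| ≤ K / a * Real.exp (-a * |x|) := by
  have key : ∀ {g g' : ℝ → ℝ}, (∀ x, HasDerivAt g (g' x) x) → Continuous g' →
      Integrable g volume → (∀ x, |g' x| ≤ K * Real.exp (-a * |x|)) →
      ∀ x, 0 ≤ x → |g x| ≤ K / a * Real.exp (-a * |x|) := by
    intro g g' h hg'm hg hg' x hx
    have hi : Integrable g' volume := ((integrable_exp_neg_mul_abs ha).const_mul K).mono'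
      hg'm.aestronglyMeasurable (ae_of_all _ hg')
    have hlim := tendsto_zero_of_hasDerivAt_of_integrableOn_Ioi (a := x) (fun y _ => h y)
      hi.integrableOn hg.integrableOn
    have hI := integral_Ioi_of_hasDerivAt_of_tendsto' (a := x) (fun y _ => h y)
      hi.integrableOn hlim
    have hnorm : ‖∫ y in Set.Ioi x, g' y‖ ≤ ∫ y in Set.Ioi x, K * Real.exp (-a * y) := by
      refine norm_integral_le_of_norm_le ((exp_neg_integrableOn_Ioi x ha).const_mul K) ?_
      refine (ae_restrict_iff' measurableSet_Ioi).mpr (ae_of_all _ fun y hy => ?_)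
      have := hg' y
      rwa [abs_of_nonneg (hx.trans (Set.mem_Ioi.mp hy).le)] at this
    rw [hI, zero_sub, norm_neg, integral_const_mul, integral_exp_mul_Ioi (by linarith)] at hnorm
    rw [abs_of_nonneg hx]
    refine hnorm.trans_eq ?_
    field_simp
  rcases le_or_gt 0 x with hx | hx
  · exact key h hg'm hg hg' x hx
  · have h2 := key (g := fun y => g (-y)) (g' := fun y => -g' (-y))
      (fun y => by simpa [Function.comp_def] using (h (-y)).comp y (hasDerivAt_neg y))
      (by fun_prop) hg.comp_neg (fun y => by simpa using hg' (-y)) (-x) (by linarith)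
    simpa using h2

lemma hasDerivAt_iteratedDeriv {g : ℝ → ℝ} (hg : ContDiff ℝ ((⊤ : ℕ∞) : WithTop ℕ∞) g) (k : ℕ)
    (x : ℝ) : HasDerivAt (iteratedDeriv k g) (iteratedDeriv (k + 1) g x) x := by
  rw [iteratedDeriv_succ]
  exact (hg.differentiable_iteratedDeriv k
    (by exact_mod_cast ENat.natCast_lt_top k) x).hasDerivAt

lemma continuous_iteratedDeriv {g : ℝ → ℝ} (hg : ContDiff ℝ ((⊤ : ℕ∞) : WithTop ℕ∞) g) (k : ℕ) :
    Continuous (iteratedDeriv k g) :=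
  continuous_iff_continuousAt.mpr fun x => (hasDerivAt_iteratedDeriv hg k x).continuousAt

/-- Half of the exponential rate is given up to absorb the polynomial factors. -/
lemma HasExponentialDerivatives.exists_abs_iteratedDeriv_le {g : ℝ → ℝ} {α : ℝ}
    (h : HasExponentialDerivatives g α) (hα : 0 < α)
    (hg : ContDiff ℝ ((⊤ : ℕ∞) : WithTop ℕ∞) g) (hg_int : Integrable g volume) (k : ℕ) :
    ∃ K, 0 ≤ K ∧ ∀ x, |iteratedDeriv k g x| ≤ K * Real.exp (-(α / 2) * |x|) := by
  have hpos : ∀ k, 1 ≤ k →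
      ∃ K, 0 ≤ K ∧ ∀ x, |iteratedDeriv k g x| ≤ K * Real.exp (-(α / 2) * |x|) := by
    intro k hk
    obtain ⟨c, C, -, -, hc, hC⟩ := h k hk
    refine exists_forall_abs_le_mul_exp (continuous_iteratedDeriv hg k)
      (hC.isBigO.trans (isBigO_eval_mul_exp C hα)) ?_
    have h1 := hc.isBigO.comp_tendsto tendsto_neg_atTop_atBot
    refine h1.trans ((isBigO_eval_mul_exp (c.comp (-Polynomial.X)) hα).congr_left fun t => ?_)
    simp
  rcases Nat.eq_zero_or_pos k with rfl | hk
  · obtain ⟨K, hK, hK'⟩ := hpos 1 le_rfl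
    refine ⟨K / (α / 2), by positivity, ?_⟩
    have h0 := hasDerivAt_iteratedDeriv hg 0
    rw [iteratedDeriv_zero] at h0 ⊢
    exact abs_le_of_abs_deriv_le h0 (continuous_iteratedDeriv hg 1) hg_int (half_pos hα) hK'
  · exact hpos k hk

/-- A nonzero polynomial stays away from zero near infinity. Order one gives the speed of the phase,
order two the constant sign of its second derivative. -/
lemma HasExponentialDerivatives.exists_le_abs_iteratedDeriv {g : ℝ → ℝ} {α : ℝ}
    (h : HasExponentialDerivatives g α) {k : ℕ} (hk : 1 ≤ k) :
    ∃ R c, 0 < c ∧ ∀ x, R ≤ x → c * Real.exp (-α * x) ≤ |iteratedDeriv k g x| := by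
  obtain ⟨-, C, -, hC0, -, hC⟩ := h k hk
  obtain ⟨c, hc, hb⟩ := ((isBigO_exp_eval_mul_exp hC0 α).trans hC.isBigO_symm).exists_pos
  obtain ⟨R, hR⟩ := eventually_atTop.mp hb.bound
  refine ⟨R, c⁻¹, inv_pos.mpr hc, fun x hx => ?_⟩
  have := hR x hx
  rw [Real.norm_eq_abs, Real.abs_exp, Real.norm_eq_abs] at this
  rwa [inv_mul_le_iff₀ hc]

lemma nonneg_or_nonpos_of_ne_zero {f : ℝ → ℝ} (hf : Continuous f) {R : ℝ}
    (h : ∀ x, R ≤ x → f x ≠ 0) : (∀ x, R ≤ x → 0 ≤ f x) ∨ ∀ x, R ≤ x → f x ≤ 0 := by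
  by_contra! hcon
  obtain ⟨⟨x, hx, hx0⟩, y, hy, hy0⟩ := hcon
  obtain ⟨z, hz, hz0⟩ := isPreconnected_Ici.intermediate_value (a := x) (b := y) hx hy
    hf.continuousOn ⟨hx0.le, hy0.le⟩
  exact h z hz hz0

end Kernel

/-! ### Smallness of a function with many zeros -/

section Rolle

/-- A repeated application of Rolle's theorem. -/
lemma abs_le_of_card_zeros {a b : ℝ} (k : ℕ) : ∀ (F : ℕ → ℝ → ℝ),
    (∀ j x, HasDerivAt (F j) (F (j + 1) x) x) → ∀ (s : Finset ℝ), k ≤ s.card →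
    (∀ x ∈ s, x ∈ Set.Icc a b ∧ F 0 x = 0) → ∀ M, (∀ x ∈ Set.Icc a b, |F k x| ≤ M) →
    ∀ x ∈ Set.Icc a b, |F 0 x| ≤ M * (b - a) ^ k := by
  induction k with
  | zero =>
    intro F _ s _ _ M hM x hx
    simpa using hM x hx
  | succ k ih =>
    intro F hF s hs hs0 M hM x hx
    obtain ⟨s', hs's, hs'⟩ := Finset.exists_subset_card_eq hs
    have hz : ∀ i, s'.orderEmbOfFin hs' i ∈ s := fun i => hs's (s'.orderEmbOfFin_mem hs' i)
    have hc : Continuous (F 0) := continuous_iff_continuousAt.mpr fun x => (hF 0 x).continuousAt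
    -- Between consecutive zeros of `F 0` lie `k` distinct zeros of `F 1`. The induction bounds `F
    -- 1`, and integrating from one zero of `F 0` gains a further factor `b - a`.
    have hroll : ∀ i : Fin k, ∃ y ∈ Set.Ioo (s'.orderEmbOfFin hs' i.castSucc)
        (s'.orderEmbOfFin hs' i.succ), F 1 y = 0 := fun i =>
      exists_hasDerivAt_eq_zero ((s'.orderEmbOfFin hs').strictMono i.castSucc_lt_succ)
        hc.continuousOn (by rw [(hs0 _ (hz _)).2, (hs0 _ (hz _)).2]) fun y _ => hF 0 y
    choose y hy hy0 using hroll
    have hinj : Function.Injective y := by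
      have hlt : ∀ i j, i < j → y i < y j := fun i j hij =>
        (hy i).2.trans_le (((s'.orderEmbOfFin hs').monotone
          (Fin.le_def.mpr (by simpa using Fin.lt_def.mp hij))).trans (hy j).1.le)
      exact (show StrictMono y from fun i j hij => hlt i j hij).injective
    have hF1 := ih (fun j => F (j + 1)) (fun j => hF (j + 1)) (Finset.univ.image y)
      (by rw [Finset.card_image_of_injective _ hinj]; simp)
      (by
        intro z hz'
        obtain ⟨i, -, rfl⟩ := Finset.mem_image.mp hz'
        exact ⟨⟨(hs0 _ (hz _)).1.1.trans (hy i).1.le, (hy i).2.le.trans (hs0 _ (hz _)).1.2⟩,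
          hy0 i⟩) M hM
    obtain ⟨hx0, hF0⟩ := hs0 _ (hz 0)
    have hmv := (convex_Icc a b).norm_image_sub_le_of_norm_hasDerivWithin_le
      (fun z _ => (hF 0 z).hasDerivWithinAt) hF1 hx0 hx
    rw [hF0, sub_zero, Real.norm_eq_abs, Real.norm_eq_abs] at hmv
    have hM0 : 0 ≤ M * (b - a) ^ k := (abs_nonneg _).trans (hF1 x hx)
    calc |F 0 x| ≤ M * (b - a) ^ k * |x - s'.orderEmbOfFin hs' 0| := hmv
      _ ≤ M * (b - a) ^ k * (b - a) := by
        refine mul_le_mul_of_nonneg_left (abs_le.mpr ⟨?_, ?_⟩) hM0 <;>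
          linarith [hx.1, hx.2, hx0.1, hx0.2]
      _ = _ := by ring

end Rolle

/-! ### Counting zeros by a grid -/

section CountZeros

/-- By pigeonhole, too many zeros put more than `k` in one cell, and Rolle's bound then contradicts
`h` at its left end. There are `n + 1` cells because `t = T` falls in cell `n`; this cell overshoots
to `T + 2 * T / n ≤ 3 * T`, whence the range of `hM`. -/
lemma encard_zeros_le {F : ℕ → ℝ → ℝ} (hF : ∀ j x, HasDerivAt (F j) (F (j + 1) x) x)
    {T M : ℝ} (hT : 0 < T) {n : ℕ} (hn : 1 ≤ n) (k : ℕ) (hM : ∀ x, |x| ≤ 3 * T → |F k x| ≤ M)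
    {I : Set ℝ} (hI : I ⊆ Set.Icc (-T) T)
    (h : ∀ j ≤ n, M * (2 * T / n) ^ k < |F 0 (-T + j * (2 * T / n))|) :
    {t | t ∈ I ∧ F 0 t = 0}.encard ≤ ((n + 1) * k : ℕ) := by
  by_contra! hlt
  obtain ⟨s, hs, hcard⟩ := Set.exists_subset_encard_eq (Order.add_one_le_of_lt hlt)
  have hfin : s.Finite := Set.finite_of_encard_eq_coe (k := (n + 1) * k + 1) (by
    rw [hcard]; push_cast; rfl)
  obtain ⟨s, rfl⟩ := hfin.exists_finset_coe
  have hcard' : s.card = (n + 1) * k + 1 := by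
    rw [Set.encard_coe_eq_coe_finsetCard] at hcard
    exact_mod_cast hcard
  have hn' : (0 : ℝ) < n := by exact_mod_cast hn
  set d := 2 * T / n with hd
  have hd0 : 0 < d := by positivity
  have hdn : d * n = 2 * T := by rw [hd]; field_simp
  have hd2 : d ≤ 2 * T := div_le_self (by positivity) (by exact_mod_cast hn)
  have hmaps : ∀ t ∈ s, ⌊(t + T) / d⌋₊ ∈ Finset.range (n + 1) := by
    intro t ht
    have ht' := hI (hs ht).1
    rw [Finset.mem_range, Nat.lt_succ_iff]
    refine Nat.floor_le_of_le ?_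
    rw [div_le_iff₀ hd0]
    linarith [ht'.2]
  obtain ⟨j, hj, hjc⟩ := Finset.exists_lt_card_fiber_of_mul_lt_card_of_maps_to (n := k) hmaps
    (by rw [Finset.card_range, hcard']; omega)
  have hjn : j ≤ n := Nat.lt_succ_iff.mp (Finset.mem_range.mp hj)
  have hjn' : (j : ℝ) * d ≤ 2 * T := by
    rw [← hdn, mul_comm]
    gcongr
  have hj0 : 0 ≤ (j : ℝ) * d := by positivity
  have hb := abs_le_of_card_zeros (a := -T + j * d) (b := -T + j * d + d) k F hF
    (s.filter fun t => ⌊(t + T) / d⌋₊ = j) hjc.le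
    (fun t ht => by
      obtain ⟨hts, htj⟩ := Finset.mem_filter.mp ht
      refine ⟨?_, (hs hts).2⟩
      have ht' := hI (hs hts).1
      have h0 : 0 ≤ (t + T) / d := div_nonneg (by linarith [ht'.1]) hd0.le
      have h1 := Nat.floor_le h0
      have h2 := Nat.lt_floor_add_one ((t + T) / d)
      rw [htj] at h1 h2
      rw [le_div_iff₀ hd0] at h1
      rw [div_lt_iff₀ hd0] at h2
      constructor <;> linarith)
    M (fun x hx => hM x (abs_le.mpr ⟨by linarith [hx.1], by linarith [hx.2]⟩))
    (-T + j * d) ⟨le_rfl, by linarith⟩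
  rw [add_sub_cancel_left] at hb
  exact absurd hb (not_le.mpr (h j hjn))

end CountZeros

/-! ### Smoothness of the paths -/

section Paths

variable {b x : ℕ → ℝ} {a : ℝ}

/-- The triangle inequality separates `t` from the points, so one series `∑ |b i| * exp (-a * |x
i|)` dominates all derivatives, locally uniformly in `t`. -/
lemma abs_mul_comp_sub_le {f : ℝ → ℝ} {K : ℝ} (ha : 0 ≤ a)
    (hK : 0 ≤ K) (hf : ∀ y, |f y| ≤ K * Real.exp (-a * |y|)) (t : ℝ) (i : ℕ) :
    |b i * f (t - x i)| ≤ K * Real.exp (a * |t|) * (|b i| * Real.exp (-a * |x i|)) := by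
  rw [abs_mul]
  calc |b i| * |f (t - x i)| ≤ |b i| * (K * Real.exp (-a * |t - x i|)) := by
        gcongr; exact hf _
    _ ≤ |b i| * (K * Real.exp (a * |t| + -a * |x i|)) := by
        gcongr
        have : |x i| ≤ |t| + |t - x i| := by
          have := abs_sub t (t - x i)
          rwa [sub_sub_cancel] at this
        nlinarith
    _ = _ := by rw [Real.exp_add]; ring

lemma summable_mul_comp_sub {f : ℝ → ℝ} {K : ℝ} (ha : 0 ≤ a) (hK : 0 ≤ K)
    (hb : Summable fun i => |b i| * Real.exp (-a * |x i|))
    (hf : ∀ y, |f y| ≤ K * Real.exp (-a * |y|)) (t : ℝ) : Summable fun i => b i * f (t - x i) :=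
  Summable.of_norm_bounded (hb.mul_left (K * Real.exp (a * |t|)))
    fun i => by rw [Real.norm_eq_abs]; exact abs_mul_comp_sub_le ha hK hf t i

lemma abs_tsum_mul_comp_sub_le {f : ℝ → ℝ} {K : ℝ} (ha : 0 ≤ a) (hK : 0 ≤ K)
    (hb : Summable fun i => |b i| * Real.exp (-a * |x i|))
    (hf : ∀ y, |f y| ≤ K * Real.exp (-a * |y|)) (t : ℝ) :
    |∑' i, b i * f (t - x i)| ≤
      K * Real.exp (a * |t|) * ∑' i, |b i| * Real.exp (-a * |x i|) := by
  have h : ∀ i, ‖b i * f (t - x i)‖ ≤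
      K * Real.exp (a * |t|) * (|b i| * Real.exp (-a * |x i|)) := fun i => by
    rw [Real.norm_eq_abs]
    exact abs_mul_comp_sub_le ha hK hf t i
  have hs : HasSum (fun i => K * Real.exp (a * |t|) * (|b i| * Real.exp (-a * |x i|)))
      (K * Real.exp (a * |t|) * ∑' i, |b i| * Real.exp (-a * |x i|)) := hb.hasSum.mul_left _
  exact tsum_of_norm_bounded hs h

lemma hasDerivAt_tsum_mul_comp_sub {f f' : ℝ → ℝ} {K K' : ℝ} (ha : 0 ≤ a) (hK : 0 ≤ K)
    (hK' : 0 ≤ K')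
    (hb : Summable fun i => |b i| * Real.exp (-a * |x i|))
    (hf : ∀ y, |f y| ≤ K * Real.exp (-a * |y|)) (hf' : ∀ y, |f' y| ≤ K' * Real.exp (-a * |y|))
    (hd : ∀ y, HasDerivAt f (f' y) y) (t : ℝ) :
    HasDerivAt (fun t => ∑' i, b i * f (t - x i)) (∑' i, b i * f' (t - x i)) t := by
  have ht : t ∈ Metric.ball t 1 := Metric.mem_ball_self one_pos
  have h1 : ∀ i, ∀ y ∈ Metric.ball t 1,
      HasDerivAt (fun y => b i * f (y - x i)) (b i * f' (y - x i)) y := fun i y _ =>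
    ((hd (y - x i)).comp_sub_const y (x i)).const_mul (b i)
  have h2 : ∀ i, ∀ y ∈ Metric.ball t 1, ‖b i * f' (y - x i)‖ ≤
      K' * Real.exp (a * (|t| + 1)) * (|b i| * Real.exp (-a * |x i|)) := fun i y hy => by
    rw [Real.norm_eq_abs]
    refine (abs_mul_comp_sub_le ha hK' hf' y i).trans ?_
    rw [Metric.mem_ball, Real.dist_eq] at hy
    have h3 : |y| ≤ |t| + 1 := by linarith [abs_sub_abs_le_abs_sub y t]
    gcongr
  exact hasDerivAt_tsum_of_isPreconnected (g := fun i y => b i * f (y - x i))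
    (g' := fun i y => b i * f' (y - x i)) (hb.mul_left (K' * Real.exp (a * (|t| + 1))))
    Metric.isOpen_ball (convex_ball t 1).isPreconnected h1 h2 ht
    (summable_mul_comp_sub ha hK hb hf t) ht

end Paths

/-! ### Measurability of the number of crossings -/

section Measurability

variable {Ω : Type*} [MeasurableSpace Ω] {X : ℝ → Ω → ℝ}

/-- By continuity and compactness, the level is attained exactly when `|X - u|` takes arbitrarily
small values on a countable dense subset of `K`. -/
lemma measurableSet_exists_eq_of_isCompact (hX : ∀ t, Measurable (X t))
    (hc : ∀ ω, Continuous fun t => X t ω) {K : Set ℝ} (hK : IsCompact K) (u : ℝ) :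
    MeasurableSet {ω | ∃ t ∈ K, X t ω = u} := by
  obtain ⟨D, hDK, hD, hKD⟩ :=
    (TopologicalSpace.IsSeparable.of_separableSpace K).exists_countable_dense_subset
  have h : {ω | ∃ t ∈ K, X t ω = u} =
      ⋂ n : ℕ, ⋃ r ∈ D, {ω | |X r ω - u| < 1 / ((n : ℝ) + 1)} := by
    ext ω
    simp only [Set.mem_ofPred_eq, Set.mem_iInter, Set.mem_iUnion, exists_prop]
    have hcont : Continuous fun t => |X t ω - u| := ((hc ω).sub continuous_const).abs
    constructor
    · rintro ⟨t, ht, rfl⟩ n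
      obtain ⟨r, hr, hrD⟩ := mem_closure_iff.mp (hKD ht) {r | |X r ω - X t ω| < 1 / ((n : ℝ) + 1)}
        (isOpen_lt hcont continuous_const) (by
          simp only [Set.mem_ofPred_eq, sub_self, abs_zero]; positivity)
      exact ⟨r, hrD, hr⟩
    · intro h
      obtain ⟨r, hr, -⟩ := h 0
      obtain ⟨t, ht, hmin⟩ := hK.exists_isMinOn ⟨r, hDK hr⟩ hcont.continuousOn
      refine ⟨t, ht, ?_⟩
      by_contra hne
      obtain ⟨n, hn⟩ := exists_nat_one_div_lt (abs_pos.mpr (sub_ne_zero.mpr hne))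
      obtain ⟨r, hr, hr'⟩ := h n
      exact absurd (isMinOn_iff.mp hmin r (hDK hr)) (not_le.mpr (hr'.trans hn))
  rw [h]
  exact MeasurableSet.iInter fun n => MeasurableSet.biUnion hD fun r _ =>
    measurableSet_lt (((hX r).sub_const u).abs) measurable_const

/-- Endpoints are the rationals of `A`, together with its least and greatest elements when these
exist. -/
lemma exists_countable_biUnion_Icc {A : Set ℝ} (hA : A.OrdConnected) :
    ∃ D : Set ℝ, D.Countable ∧ A = ⋃ p ∈ D, ⋃ q ∈ D, Set.Icc p q := by
  have hs1 : {x ∈ A | x ∈ lowerBounds A}.Subsingleton := fun x hx y hy =>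
    le_antisymm (hx.2 hy.1) (hy.2 hx.1)
  have hs2 : {x ∈ A | x ∈ upperBounds A}.Subsingleton := fun x hx y hy =>
    le_antisymm (hy.2 hx.1) (hx.2 hy.1)
  refine ⟨A ∩ Set.range ((↑) : ℚ → ℝ) ∪ ({x ∈ A | x ∈ lowerBounds A} ∪
    {x ∈ A | x ∈ upperBounds A}), ?_, ?_⟩
  · exact ((Set.countable_range _).mono Set.inter_subset_right).union
      (hs1.countable.union hs2.countable)
  · refine Set.Subset.antisymm (fun x hx => ?_) ?_
    · have hp : ∃ p ∈ A ∩ Set.range ((↑) : ℚ → ℝ) ∪ ({x ∈ A | x ∈ lowerBounds A} ∪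
          {x ∈ A | x ∈ upperBounds A}), p ≤ x := by
        by_cases h : x ∈ lowerBounds A
        · exact ⟨x, Or.inr (Or.inl ⟨hx, h⟩), le_rfl⟩
        · simp only [lowerBounds, Set.mem_ofPred_eq, not_forall, not_le] at h
          obtain ⟨y, hy, hyx⟩ := h
          obtain ⟨r, hr1, hr2⟩ := exists_rat_btwn hyx
          exact ⟨r, Or.inl ⟨hA.out hy hx ⟨hr1.le, hr2.le⟩, r, rfl⟩, hr2.le⟩
      have hq : ∃ q ∈ A ∩ Set.range ((↑) : ℚ → ℝ) ∪ ({x ∈ A | x ∈ lowerBounds A} ∪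
          {x ∈ A | x ∈ upperBounds A}), x ≤ q := by
        by_cases h : x ∈ upperBounds A
        · exact ⟨x, Or.inr (Or.inr ⟨hx, h⟩), le_rfl⟩
        · simp only [upperBounds, Set.mem_ofPred_eq, not_forall, not_le] at h
          obtain ⟨y, hy, hyx⟩ := h
          obtain ⟨r, hr1, hr2⟩ := exists_rat_btwn hyx
          exact ⟨r, Or.inl ⟨hA.out hx hy ⟨hr1.le, hr2.le⟩, r, rfl⟩, hr1.le⟩
      obtain ⟨p, hpD, hpx⟩ := hp
      obtain ⟨q, hqD, hqx⟩ := hq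
      exact Set.mem_biUnion hpD (Set.mem_biUnion hqD ⟨hpx, hqx⟩)
    · refine Set.iUnion₂_subset fun p hp => Set.iUnion₂_subset fun q hq => hA.out ?_ ?_
      · rcases hp with h | h | h <;> exact h.1
      · rcases hq with h | h | h <;> exact h.1

lemma measurableSet_exists_eq_of_ordConnected (hX : ∀ t, Measurable (X t))
    (hc : ∀ ω, Continuous fun t => X t ω) {A : Set ℝ} (hA : A.OrdConnected) (u : ℝ) :
    MeasurableSet {ω | ∃ t ∈ A, X t ω = u} := by
  obtain ⟨D, hD, rfl⟩ := exists_countable_biUnion_Icc hA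
  have h : {ω | ∃ t ∈ ⋃ p ∈ D, ⋃ q ∈ D, Set.Icc p q, X t ω = u} =
      ⋃ p ∈ D, ⋃ q ∈ D, {ω | ∃ t ∈ Set.Icc p q, X t ω = u} := by
    ext ω
    simp only [Set.mem_ofPred_eq, Set.mem_iUnion, exists_prop]
    constructor
    · rintro ⟨t, ⟨p, hp, q, hq, ht⟩, h⟩
      exact ⟨p, hp, q, hq, t, ht, h⟩
    · rintro ⟨p, hp, q, hq, t, ht, h⟩
      exact ⟨t, ⟨p, hp, q, hq, ht⟩, h⟩
  rw [h]
  exact MeasurableSet.biUnion hD fun p _ => MeasurableSet.biUnion hD fun q _ =>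
    measurableSet_exists_eq_of_isCompact hX hc isCompact_Icc u

/-- Finitely many distinct points fall in distinct cells of a fine enough grid. This expresses "at
least `m` zeros" through countably many events that a zero exists in a given cell. -/
lemma natCast_le_encard_iff_floor (Z : Set ℝ) (m : ℕ) :
    (m : ℕ∞) ≤ Z.encard ↔
      ∃ (n : ℕ) (s : Finset ℤ), s.card = m ∧ ∀ j ∈ s, ∃ t ∈ Z, ⌊t * ((n : ℝ) + 1)⌋ = j := by
  constructor
  · intro h
    obtain ⟨s, hs, hcard⟩ := Set.exists_subset_encard_eq h
    obtain ⟨s, rfl⟩ := (Set.finite_of_encard_eq_coe hcard).exists_finset_coe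
    rw [Set.encard_coe_eq_coe_finsetCard, Nat.cast_inj] at hcard
    have hev : ∀ᶠ n : ℕ in atTop, ∀ t ∈ s, ∀ t' ∈ s, ⌊t * ((n : ℝ) + 1)⌋ = ⌊t' * ((n : ℝ) + 1)⌋ →
        t = t' := by
      rw [Filter.eventually_all_finset]
      intro t _
      rw [Filter.eventually_all_finset]
      intro t' _
      by_cases htt : t = t'
      · exact Eventually.of_forall fun _ _ => htt
      · have hpos : 0 < |t - t'| := abs_pos.mpr (sub_ne_zero.mpr htt)
        obtain ⟨N, hN⟩ := exists_nat_gt (1 / |t - t'|)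
        filter_upwards [eventually_ge_atTop N] with n hn hfl
        have h1 := Int.abs_sub_lt_one_of_floor_eq_floor hfl
        rw [← sub_mul, abs_mul, abs_of_pos (by positivity : (0 : ℝ) < n + 1)] at h1
        rw [div_lt_iff₀ hpos] at hN
        have hNn : (N : ℝ) ≤ n := by exact_mod_cast hn
        nlinarith
    obtain ⟨n, hn⟩ := hev.exists
    refine ⟨n, s.image fun t => ⌊t * ((n : ℝ) + 1)⌋, ?_, ?_⟩
    · rw [Finset.card_image_of_injOn fun t ht t' ht' h => hn t ht t' ht' h, hcard]
    · intro j hj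
      obtain ⟨t, ht, rfl⟩ := Finset.mem_image.mp hj
      exact ⟨t, hs ht, rfl⟩
  · rintro ⟨n, s, rfl, h⟩
    choose! f hf hfl using h
    have hinj : Set.InjOn f s := fun i hi j hj hij => by rw [← hfl i hi, ← hfl j hj, hij]
    rw [← Set.encard_coe_eq_coe_finsetCard, ← hinj.encard_image]
    exact Set.encard_le_encard (Set.image_subset_iff.mpr hf)

/-- The number of crossings of a measurable process with continuous paths is measurable. -/
lemma measurable_crossings (hX : ∀ t, Measurable (X t))
    (hc : ∀ ω, Continuous fun t => X t ω) {I : Set ℝ} (hI : I.OrdConnected) (u : ℝ) :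
    Measurable (crossings X I u) := by
  have hm : ∀ m : ℕ, MeasurableSet {ω | (m : ℕ∞) ≤ crossings X I u ω} := by
    intro m
    have hset : {ω | (m : ℕ∞) ≤ crossings X I u ω} = ⋃ (n : ℕ) (s : Finset ℤ) (_ : s.card = m),
        ⋂ j ∈ s, {ω | ∃ t ∈ I ∩ (fun t : ℝ => ⌊t * ((n : ℝ) + 1)⌋) ⁻¹' {j}, X t ω = u} := by
      ext ω
      simp only [crossings, Set.mem_ofPred_eq, natCast_le_encard_iff_floor, Set.mem_iUnion,
        Set.mem_iInter, exists_prop, Set.mem_inter_iff, Set.mem_preimage, Set.mem_singleton_iff]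
      refine exists_congr fun n => exists_congr fun s => and_congr_right fun _ =>
        forall₂_congr fun j _ => exists_congr fun t => ?_
      tauto
    rw [hset]
    refine MeasurableSet.iUnion fun n => MeasurableSet.iUnion fun s => MeasurableSet.iUnion fun _ =>
      Finset.measurableSet_biInter _ fun j _ => measurableSet_exists_eq_of_ordConnected hX hc ?_ u
    refine hI.inter (Set.ordConnected_singleton.preimage_mono fun t t' htt => ?_)
    exact Int.floor_le_floor (by gcongr)
  refine measurable_to_countable' fun n => ?_
  induction n using ENat.recTopCoe with
  | top =>
    have : crossings X I u ⁻¹' {⊤} = ⋂ m : ℕ, {ω | (m : ℕ∞) ≤ crossings X I u ω} := by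
      ext ω
      simp only [Set.mem_preimage, Set.mem_singleton_iff, Set.mem_iInter, Set.mem_ofPred_eq]
      exact ENat.eq_top_iff_forall_ge
    rw [this]
    exact MeasurableSet.iInter hm
  | coe n =>
    have : crossings X I u ⁻¹' {(n : ℕ∞)} = {ω | (n : ℕ∞) ≤ crossings X I u ω} \
        {ω | ((n + 1 : ℕ) : ℕ∞) ≤ crossings X I u ω} := by
      ext ω
      simp only [Set.mem_preimage, Set.mem_singleton_iff, Set.mem_sdiff, Set.mem_ofPred_eq, not_le]
      push_cast
      rw [ENat.lt_add_one_iff (ENat.natCast_ne_top n)]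
      exact ⟨fun h => ⟨h.ge, h.le⟩, fun h => le_antisymm h.2 h.1⟩
    rw [this]
    exact (hm n).diff (hm (n + 1))

end Measurability

/-! ### Moments from tail bounds -/

section Moments

variable {Ω : Type*} [MeasurableSpace Ω] {P : Measure Ω} {τ β : ℕ → Ω → ℝ} {l : ℝ}

/-- A finite `N > 2 * k` lies in one block `((n + 2) * k, (n + 3) * k]`, whose term suffices. For `N
= ⊤` all terms are present and at least `1`, so the series is infinite. -/
lemma rpow_le_add_tsum (N : ℕ∞) {k : ℕ} (hk : 1 ≤ k) {p : ℝ} (hp : 0 < p) :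
    (N : ℝ≥0∞) ^ p ≤ ((2 * k : ℕ) : ℝ≥0∞) ^ p +
      ∑' n : ℕ, {m : ℕ∞ | ((n + 2) * k : ℕ) < m}.indicator
        (fun _ => (((n + 3) * k : ℕ) : ℝ≥0∞) ^ p) N := by
  induction N using ENat.recTopCoe with
  | top =>
    refine le_add_left ?_
    refine le_top.trans (le_of_eq (Eq.symm ?_))
    rw [← top_le_iff, ← ENNReal.tsum_const_eq_top_of_ne_zero (α := ℕ) one_ne_zero]
    refine ENNReal.tsum_le_tsum fun n => ?_
    rw [Set.indicator_of_mem (show (⊤ : ℕ∞) ∈ {m : ℕ∞ | ((n + 2) * k : ℕ) < m} from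
      ENat.natCast_lt_top _)]
    exact ENNReal.one_le_rpow (by exact_mod_cast Nat.succ_le_of_lt (by positivity)) hp
  | coe N =>
    rw [ENat.toENNReal_coe]
    rcases Nat.lt_or_ge (2 * k) N with h | h
    · refine le_add_left ?_
      set n := (N - 1) / k - 2 with hn
      have h2 : 2 ≤ (N - 1) / k := (Nat.le_div_iff_mul_le (by omega)).mpr (by omega)
      have hdm := Nat.div_add_mod (N - 1) k
      have hml := Nat.mod_lt (N - 1) (show 0 < k by omega)
      have hn2 : n + 2 = (N - 1) / k := by omega
      have hlo : (n + 2) * k < N := by rw [hn2, mul_comm]; omega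
      have hhi : N ≤ (n + 3) * k := by
        have : (n + 3) * k = k * ((N - 1) / k) + k := by rw [← hn2]; ring
        omega
      refine le_trans ?_ (ENNReal.le_tsum n)
      rw [Set.indicator_of_mem (by simpa using (by exact_mod_cast hlo))]
      exact ENNReal.rpow_le_rpow (by exact_mod_cast hhi) hp.le
    · exact le_add_right (ENNReal.rpow_le_rpow (by exact_mod_cast h) hp.le)

lemma lintegral_rpow_lt_top_of_tail_le [IsProbabilityMeasure P] {N : Ω → ℕ∞} (hN : Measurable N)
    {k : ℕ} (hk : 1 ≤ k) {p A : ℝ} (hp : 0 < p) (hA : 0 ≤ A)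
    (h : ∀ n : ℕ, 1 ≤ n →
      P {ω | ((n + 1) * k : ℕ) < N ω} ≤ ENNReal.ofReal (A * (n : ℝ) ^ (-(p + 2)))) :
    ∫⁻ ω, (N ω : ℝ≥0∞) ^ p ∂P < ∞ := by
  have hm : ∀ n : ℕ, MeasurableSet {ω | (((n + 2) * k : ℕ) : ℕ∞) < N ω} := fun n =>
    hN (MeasurableSet.of_discrete (s := {m : ℕ∞ | ((n + 2) * k : ℕ) < m}))
  -- The tail hypothesis is used at `n + 1`, and `(n + 3) * k ≤ 3 * k * (n + 1)`; the powers `p` and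
  -- `-(p + 2)` combine to `-2`.
  have hsum : Summable fun n : ℕ => ((3 * k : ℕ) : ℝ) ^ p * A * ((n + 1 : ℕ) : ℝ) ^ (-2 : ℝ) :=
    ((summable_nat_add_iff 1).mpr (Real.summable_nat_rpow.mpr (by norm_num))).mul_left _
  calc ∫⁻ ω, (N ω : ℝ≥0∞) ^ p ∂P
      ≤ ∫⁻ ω, (((2 * k : ℕ) : ℝ≥0∞) ^ p + ∑' n : ℕ,
          {ω | (((n + 2) * k : ℕ) : ℕ∞) < N ω}.indicator
            (fun _ => (((n + 3) * k : ℕ) : ℝ≥0∞) ^ p) ω) ∂P :=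
        lintegral_mono fun ω => rpow_le_add_tsum (N ω) hk hp
    _ = ((2 * k : ℕ) : ℝ≥0∞) ^ p + ∑' n : ℕ,
          (((n + 3) * k : ℕ) : ℝ≥0∞) ^ p * P {ω | (((n + 2) * k : ℕ) : ℕ∞) < N ω} := by
        rw [lintegral_add_left measurable_const, lintegral_const, measure_univ, mul_one,
          lintegral_tsum fun n => (measurable_const.indicator (hm n)).aemeasurable]
        congr 2
        funext n
        rw [lintegral_indicator_const (hm n)]
    _ ≤ ((2 * k : ℕ) : ℝ≥0∞) ^ p + ∑' n : ℕ,
          ENNReal.ofReal (((3 * k : ℕ) : ℝ) ^ p * A * ((n + 1 : ℕ) : ℝ) ^ (-2 : ℝ)) := by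
        gcongr with n
        have hn := h (n + 1) (by omega)
        calc (((n + 3) * k : ℕ) : ℝ≥0∞) ^ p * P {ω | (((n + 2) * k : ℕ) : ℕ∞) < N ω}
            ≤ ENNReal.ofReal (((3 * k * (n + 1) : ℕ) : ℝ) ^ p) *
              ENNReal.ofReal (A * ((n + 1 : ℕ) : ℝ) ^ (-(p + 2))) := by
              gcongr
              rw [← ENNReal.ofReal_rpow_of_nonneg (by positivity) hp.le, ENNReal.ofReal_natCast]
              refine ENNReal.rpow_le_rpow ?_ hp.le
              have : (n + 3) * k ≤ 3 * k * (n + 1) := by nlinarith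
              exact_mod_cast this
          _ = _ := by
              rw [← ENNReal.ofReal_mul (by positivity)]
              congr 1
              have hn0 : (0 : ℝ) < ((n + 1 : ℕ) : ℝ) := by positivity
              rw [Nat.cast_mul, Real.mul_rpow (by positivity) (by positivity), neg_add,
                Real.rpow_add hn0, Real.rpow_neg hn0.le p]
              have : ((n + 1 : ℕ) : ℝ) ^ p ≠ 0 := by positivity
              field_simp
    _ < ∞ := by
        rw [← ENNReal.ofReal_tsum_of_nonneg (fun n => by positivity) hsum]
        exact ENNReal.add_lt_top.mpr
          ⟨ENNReal.rpow_lt_top_of_nonneg hp.le (ENNReal.natCast_ne_top _), ENNReal.ofReal_lt_top⟩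

end Moments

/-! ### Small balls, tails and a continuous version of the shot noise -/

section Main

variable {Ω : Type*} [MeasurableSpace Ω] {P : Measure Ω} {τ β : ℕ → Ω → ℝ} {l : ℝ}

lemma exists_measureReal_le_abs_pos {ν : Measure ℝ} [IsProbabilityMeasure ν] (h : ν {0} = 0) :
    ∃ δ, 0 < δ ∧ 0 < ν.real {y | δ ≤ |y|} := by
  by_contra! hcon
  have hU : (⋃ n : ℕ, {y : ℝ | 1 / ((n : ℝ) + 1) ≤ |y|}) = {0}ᶜ := by
    ext y
    simp only [Set.mem_iUnion, Set.mem_ofPred_eq, Set.mem_compl_iff, Set.mem_singleton_iff]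
    constructor
    · rintro ⟨n, hn⟩ rfl
      rw [abs_zero] at hn
      exact absurd hn (not_le.mpr (by positivity))
    · intro hy
      obtain ⟨n, hn⟩ := exists_nat_one_div_lt (abs_pos.mpr hy)
      exact ⟨n, hn.le⟩
  have h0 : ν (⋃ n : ℕ, {y : ℝ | 1 / ((n : ℝ) + 1) ≤ |y|}) = 0 := by
    refine measure_iUnion_null fun n => ?_
    have := le_antisymm (hcon (1 / ((n : ℝ) + 1)) (by positivity)) measureReal_nonneg
    exact (measureReal_eq_zero_iff).mp this
  rw [hU, prob_compl_eq_zero_iff (measurableSet_singleton 0), h] at h0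
  exact zero_ne_one h0

lemma HasBoundedDensity.map_singleton_zero {Y : Ω → ℝ} (h : HasBoundedDensity Y P) :
    P.map Y {0} = 0 := by
  obtain ⟨f, B, hf, -, hd⟩ := h
  rw [hd]
  exact withDensity_absolutelyContinuous _ _ (by simp)

lemma map_singleton_zero_of_lintegral_inv {Y : Ω → ℝ} (hY : Measurable Y)
    (h : ∫⁻ ω, ‖Y ω‖ₑ⁻¹ ∂P < ∞) : P.map Y {0} = 0 := by
  rw [Measure.map_apply hY (measurableSet_singleton 0)]
  have := ae_lt_top' (by fun_prop) h.ne
  refine measure_mono_null (fun ω hω => ?_) (ae_iff.mp this)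
  have : Y ω = 0 := hω
  simp [this]

/-- The one dimensional distributions of the shot noise have a Hölder continuous distribution
function, uniformly in time. -/
lemma exists_measure_abs_shotNoise_sub_le [IsProbabilityMeasure P]
    (hτ : IsPoissonProcess τ l P) (hβ : IsImpulses β τ P) (hl : 0 < l)
    (hβ_int : Integrable (β 0) P) (hβ0 : P.map (β 0) {0} = 0) {g : ℝ → ℝ} {α : ℝ}
    (hg : ContDiff ℝ ((⊤ : ℕ∞) : WithTop ℕ∞) g) (hg_int : Integrable g volume)
    (hα : 0 < α) (hg_exp : HasExponentialDerivatives g α) :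
    ∃ C γ : ℝ, 0 ≤ C ∧ 0 < γ ∧ ∀ t u ε : ℝ, 0 < ε →
      P {ω | |shotNoise β τ g t ω - u| ≤ ε} ≤ ENNReal.ofReal (C * ε ^ γ) := by
  have hβm := hβ.measurable
  have hτm := hτ.measurable
  have hgc : Continuous g := hg.continuous
  have hpr : IsProbabilityMeasure (P.map (β 0)) :=
    Measure.isProbabilityMeasure_map (hβm 0).aemeasurable
  obtain ⟨δ, hδ, hq⟩ := exists_measureReal_le_abs_pos hβ0
  have h1 := hasDerivAt_iteratedDeriv hg 0
  rw [iteratedDeriv_zero] at h1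
  have h2 := hasDerivAt_iteratedDeriv hg 1
  obtain ⟨R1, c, hc, hR1⟩ := hg_exp.exists_le_abs_iteratedDeriv (k := 1) le_rfl
  obtain ⟨R2, c2, hc2, hR2⟩ := hg_exp.exists_le_abs_iteratedDeriv (k := 2) one_le_two
  have hsign := nonneg_or_nonpos_of_ne_zero (continuous_iteratedDeriv hg 2) (R := max R1 R2)
    (fun x hx => abs_pos.mp (lt_of_lt_of_le (by positivity) (hR2 x ((le_max_right _ _).trans hx))))
  set q := (P.map (β 0)).real {y | δ ≤ |y|}
  set κ := l * q / α
  have hκ : 0 < κ := by positivity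
  set C := Real.exp (l * q * (max R1 R2 + 4)) * (c * δ) ^ (-κ)
  have hC : 0 ≤ C := by positivity
  have hX : ∀ t s, s ≠ 0 → ‖charFun (P.map (shotNoise β τ g t)) s‖ ≤ C * |s| ^ (-κ) :=
    fun t s hs => norm_charFun_shotNoise_le hτ hβ hl.le hβ_int h1 h2 hg_int hα hc hδ
      (fun x hx => hR1 x ((le_max_left _ _).trans hx)) hsign t s hs
  -- For `ε ≤ 1` the smaller exponent dominates both terms of the smoothing bound; for `ε > 1` the
  -- constant already exceeds `1`.
  refine ⟨Real.exp (1 / 2) * (2 + C), min (1 / 2) (κ / 2), by positivity, by positivity,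
    fun t u ε hε => ?_⟩
  have hXm : Measurable (shotNoise β τ g t) := by
    unfold shotNoise
    fun_prop
  have hprX : IsProbabilityMeasure (P.map (shotNoise β τ g t)) :=
    Measure.isProbabilityMeasure_map hXm.aemeasurable
  rcases le_or_gt ε 1 with hε1 | hε1
  · have hb := measureReal_Icc_le_of_norm_charFun_le hC hκ (hX t) u ε hε
    have hset : {ω | |shotNoise β τ g t ω - u| ≤ ε} =
        shotNoise β τ g t ⁻¹' Set.Icc (u - ε) (u + ε) := by
      ext ω
      simp only [Set.mem_ofPred_eq, Set.mem_preimage, Set.mem_Icc, abs_le]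
      constructor <;> rintro ⟨h, h'⟩ <;> constructor <;> linarith
    rw [hset, ← Measure.map_apply hXm measurableSet_Icc, ← ENNReal.ofReal_toReal
      (measure_ne_top (P.map (shotNoise β τ g t)) (Set.Icc (u - ε) (u + ε)))]
    refine ENNReal.ofReal_le_ofReal (hb.trans ?_)
    rw [mul_assoc (Real.exp (1 / 2)), add_mul 2 C]
    gcongr ?_ * (2 * ?_ + C * ?_)
    · exact Real.rpow_le_rpow_of_exponent_ge hε hε1 (min_le_left _ _)
    · exact Real.rpow_le_rpow_of_exponent_ge hε hε1 (min_le_right _ _)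
  · refine prob_le_one.trans ?_
    rw [← ENNReal.ofReal_one]
    refine ENNReal.ofReal_le_ofReal ?_
    have e1 : 1 ≤ Real.exp (1 / 2) := Real.one_le_exp (by norm_num)
    have e2 : 1 ≤ ε ^ min (1 / 2) (κ / 2) := Real.one_le_rpow hε1.le (by positivity)
    exact one_le_mul_of_one_le_of_one_le (one_le_mul_of_one_le_of_one_le e1 (by linarith)) e2

lemma summable_of_tsum_enorm_lt_top {b x : ℕ → ℝ} {a : ℝ}
    (h : ∑' i, ‖b i‖ₑ * ENNReal.ofReal (Real.exp (-a * |x i|)) < ∞) :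
    (Summable fun i => |b i| * Real.exp (-a * |x i|)) ∧
      ENNReal.ofReal (∑' i, |b i| * Real.exp (-a * |x i|)) =
        ∑' i, ‖b i‖ₑ * ENNReal.ofReal (Real.exp (-a * |x i|)) := by
  have e : ∀ i, ‖b i‖ₑ * ENNReal.ofReal (Real.exp (-a * |x i|)) =
      ENNReal.ofReal (|b i| * Real.exp (-a * |x i|)) := fun i => by
    rw [ENNReal.ofReal_mul (abs_nonneg _), Real.enorm_eq_ofReal_abs]
  simp_rw [e] at h ⊢
  have hs : Summable fun i => |b i| * Real.exp (-a * |x i|) := by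
    have := ENNReal.summable_toReal h.ne
    refine this.congr fun i => ENNReal.toReal_ofReal (by positivity)
  exact ⟨hs, ENNReal.ofReal_tsum_of_nonneg (fun i => by positivity) hs⟩

/-- The number of crossings of the shot noise has tails of arbitrarily fast polynomial decay. -/
lemma exists_measure_lt_crossings_le [IsProbabilityMeasure P]
    (hβm : ∀ i, Measurable (β i)) (hτm : ∀ i, Measurable (τ i)) {g : ℝ → ℝ} {a : ℝ}
    (hg : ContDiff ℝ ((⊤ : ℕ∞) : WithTop ℕ∞) g) (ha : 0 < a)
    (hdec : ∀ k, ∃ K, 0 ≤ K ∧ ∀ x, |iteratedDeriv k g x| ≤ K * Real.exp (-a * |x|))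
    (hG : ∫⁻ ω, ∑' i, ‖β i ω‖ₑ * ENNReal.ofReal (Real.exp (-a * |τ i ω|)) ∂P < ∞)
    {C γ : ℝ} (hC : 0 ≤ C) (hγ : 0 < γ) (hsmall : ∀ t u ε : ℝ, 0 < ε →
      P {ω | |shotNoise β τ g t ω - u| ≤ ε} ≤ ENNReal.ofReal (C * ε ^ γ))
    {I : Set ℝ} {T : ℝ} (hT : 0 < T) (hI : I ⊆ Set.Icc (-T) T) (u : ℝ) {s : ℝ} (hs : 0 < s) :
    ∃ (k : ℕ) (A : ℝ), 1 ≤ k ∧ 0 ≤ A ∧ ∀ n : ℕ, 1 ≤ n →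
      P {ω | ((n + 1) * k : ℕ) < crossings (shotNoise β τ g) I u ω} ≤
        ENNReal.ofReal (A * (n : ℝ) ^ (-s)) := by
  choose K hK0 hK using hdec
  set G : Ω → ℝ≥0∞ := fun ω => ∑' i, ‖β i ω‖ₑ * ENNReal.ofReal (Real.exp (-a * |τ i ω|))
  have hGm : Measurable G := by fun_prop
  -- This gives `(s - k) * γ ≤ -s - 1`, so the union bound over `n + 1` grid points still leaves `n
  -- ^ (-s)`.
  obtain ⟨k, hk⟩ := exists_nat_ge (s + (s + 1) / γ)
  have hk1 : 1 ≤ k := by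
    have : 0 < (k : ℝ) := lt_of_lt_of_le (by positivity) hk
    exact_mod_cast this
  -- `D * L` bounds the `k`-th derivative for `|t| ≤ 3 * T` when `G < L`; the `+ 1` makes `D`, hence
  -- the radius of the small balls, positive.
  set D := (K k + 1) * Real.exp (a * (3 * T)) with hD
  have hD0 : 0 < D := by have := hK0 k; positivity
  set E := (∫⁻ ω, G ω ∂P).toReal
  refine ⟨k, E + 2 * C * (D * (2 * T) ^ k) ^ γ, hk1, by positivity, fun n hn => ?_⟩
  have hn0 : (0 : ℝ) < n := by exact_mod_cast hn
  have hn1 : (1 : ℝ) ≤ n := by exact_mod_cast hn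
  set L := (n : ℝ) ^ s
  have hL : 0 < L := by positivity
  set d := 2 * T / n
  -- Either `G` exceeds the truncation level `L = n ^ s`, or the grid count applies with `M = D *
  -- L`.
  have hsub : {ω | (((n + 1) * k : ℕ) : ℕ∞) < crossings (shotNoise β τ g) I u ω} ⊆
      {ω | ENNReal.ofReal L ≤ G ω} ∪ ⋃ j ∈ Finset.range (n + 1),
        {ω | |shotNoise β τ g (-T + j * d) ω - u| ≤ D * L * d ^ k} := by
    intro ω hω
    by_contra hcon
    simp only [Set.mem_union, Set.mem_ofPred_eq, Set.mem_iUnion, exists_prop, not_or, not_exists,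
      not_and, not_le, Finset.mem_range, Nat.lt_succ_iff] at hcon
    obtain ⟨hω1, hω2⟩ := hcon
    obtain ⟨hsum, hsum'⟩ := summable_of_tsum_enorm_lt_top (hω1.trans ENNReal.ofReal_lt_top)
    have hS : ∑' i, |β i ω| * Real.exp (-a * |τ i ω|) ≤ L := by
      have : ENNReal.ofReal (∑' i, |β i ω| * Real.exp (-a * |τ i ω|)) ≤ ENNReal.ofReal L :=
        hsum'.trans_le hω1.le
      exact (ENNReal.ofReal_le_ofReal_iff hL.le).mp this
    have hS0 : 0 ≤ ∑' i, |β i ω| * Real.exp (-a * |τ i ω|) :=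
      tsum_nonneg fun i => by positivity
    let F : ℕ → ℝ → ℝ := fun j t =>
      (∑' i, β i ω * iteratedDeriv j g (t - τ i ω)) - if j = 0 then u else 0
    have hF : ∀ j x, HasDerivAt (F j) (F (j + 1) x) x := by
      intro j x
      have := (hasDerivAt_tsum_mul_comp_sub ha.le (hK0 j) (hK0 (j + 1)) hsum (hK j) (hK (j + 1))
        (hasDerivAt_iteratedDeriv hg j) x).sub_const (if j = 0 then u else 0)
      simpa [F] using this
    have hF0 : ∀ t, F 0 t = shotNoise β τ g t ω - u := fun t => by simp [F, shotNoise]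
    have hFk : ∀ x, |x| ≤ 3 * T → |F k x| ≤ D * L := by
      intro x hx
      have h1 : F k x = ∑' i, β i ω * iteratedDeriv k g (x - τ i ω) := by
        simp [F, show k ≠ 0 by omega]
      rw [h1]
      refine (abs_tsum_mul_comp_sub_le ha.le (hK0 k) hsum (hK k) x).trans ?_
      have := hK0 k
      rw [hD]
      gcongr
      linarith
    have hcount := encard_zeros_le hF hT hn k hFk hI (fun j hj => by rw [hF0]; exact hω2 j hj)
    refine absurd hω (not_lt.mpr (le_trans (le_of_eq ?_) hcount))
    simp only [crossings, hF0, sub_eq_zero]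
  have hd0 : 0 < d := by positivity
  have hpow : (n + 1 : ℝ) * (C * (D * L * d ^ k) ^ γ) ≤
      2 * C * (D * (2 * T) ^ k) ^ γ * (n : ℝ) ^ (-s) := by
    have h1 : D * L * d ^ k = (D * (2 * T) ^ k) * (n : ℝ) ^ (s - k) := by
      rw [Real.rpow_sub hn0, Real.rpow_natCast, div_pow]
      ring
    have h2 : ((n : ℝ) ^ (s - k)) ^ γ ≤ (n : ℝ) ^ (-s - 1) := by
      rw [← Real.rpow_mul hn0.le]
      refine Real.rpow_le_rpow_of_exponent_le hn1 ?_
      have : (s + 1) / γ * γ = s + 1 := by field_simp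
      nlinarith
    have h3 : (n : ℝ) * (n : ℝ) ^ (-s - 1) = (n : ℝ) ^ (-s) := by
      rw [Real.rpow_sub hn0, Real.rpow_one]
      field_simp
    rw [h1, Real.mul_rpow (by positivity) (by positivity)]
    calc (n + 1 : ℝ) * (C * ((D * (2 * T) ^ k) ^ γ * ((n : ℝ) ^ (s - k)) ^ γ))
        ≤ (2 * n) * (C * ((D * (2 * T) ^ k) ^ γ * (n : ℝ) ^ (-s - 1))) := by
          gcongr
          linarith
      _ = 2 * C * (D * (2 * T) ^ k) ^ γ * (n * (n : ℝ) ^ (-s - 1)) := by ring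
      _ = _ := by rw [h3]
  calc P {ω | (((n + 1) * k : ℕ) : ℕ∞) < crossings (shotNoise β τ g) I u ω}
      ≤ P {ω | ENNReal.ofReal L ≤ G ω} + ∑ j ∈ Finset.range (n + 1),
          P {ω | |shotNoise β τ g (-T + j * d) ω - u| ≤ D * L * d ^ k} :=
        (measure_mono hsub).trans ((measure_union_le _ _).trans
          (add_le_add_right (measure_biUnion_finset_le _ _) _))
    _ ≤ ENNReal.ofReal (E * (n : ℝ) ^ (-s)) + ∑ j ∈ Finset.range (n + 1),
          ENNReal.ofReal (C * (D * L * d ^ k) ^ γ) := by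
        gcongr with j hj
        · refine (meas_ge_le_lintegral_div hGm.aemeasurable (ENNReal.ofReal_pos.mpr hL).ne'
            ENNReal.ofReal_ne_top).trans_eq ?_
          rw [← ENNReal.ofReal_toReal hG.ne, ← ENNReal.ofReal_div_of_pos hL, Real.rpow_neg hn0.le]
          rfl
        · exact hsmall _ _ _ (by positivity)
    _ = ENNReal.ofReal (E * (n : ℝ) ^ (-s) + (n + 1 : ℝ) * (C * (D * L * d ^ k) ^ γ)) := by
        rw [Finset.sum_const, Finset.card_range, nsmul_eq_mul,
          ENNReal.ofReal_add (by positivity) (by positivity),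
          ENNReal.ofReal_mul (p := (n + 1 : ℝ)) (by positivity)]
        congr 2
        rw [← ENNReal.ofReal_natCast]
        push_cast
        rfl
    _ ≤ _ := by
        refine ENNReal.ofReal_le_ofReal ?_
        rw [add_mul]
        linarith

/-- The shot noise is almost surely equal to a measurable process with continuous paths. -/
lemma exists_measurable_continuous_eq_shotNoise
    (hβm : ∀ i, Measurable (β i)) (hτm : ∀ i, Measurable (τ i)) {g : ℝ → ℝ} {a : ℝ}
    (hg : ContDiff ℝ ((⊤ : ℕ∞) : WithTop ℕ∞) g) (ha : 0 < a)
    (hdec : ∀ k, ∃ K, 0 ≤ K ∧ ∀ x, |iteratedDeriv k g x| ≤ K * Real.exp (-a * |x|))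
    (hG : ∫⁻ ω, ∑' i, ‖β i ω‖ₑ * ENNReal.ofReal (Real.exp (-a * |τ i ω|)) ∂P < ∞) :
    ∃ X : ℝ → Ω → ℝ, (∀ t, Measurable (X t)) ∧ (∀ ω, Continuous fun t => X t ω) ∧
      ∀ᵐ ω ∂P, ∀ t, shotNoise β τ g t ω = X t ω := by
  have hgc : Continuous g := hg.continuous
  choose K hK0 hK using hdec
  set G : Ω → ℝ≥0∞ := fun ω => ∑' i, ‖β i ω‖ₑ * ENNReal.ofReal (Real.exp (-a * |τ i ω|))
  have hGm : Measurable G := by fun_prop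
  have hE : MeasurableSet {ω | G ω < ∞} := measurableSet_lt hGm measurable_const
  -- Setting the process to zero on the null event `G = ∞`, which does not depend on `t`, makes
  -- every path continuous.
  refine ⟨fun t => {ω | G ω < ∞}.indicator (shotNoise β τ g t), fun t => ?_, fun ω => ?_, ?_⟩
  · refine Measurable.indicator ?_ hE
    unfold shotNoise
    fun_prop
  · by_cases hω : G ω < ∞
    · have e : (fun t => {ω | G ω < ∞}.indicator (shotNoise β τ g t) ω) =
          fun t => shotNoise β τ g t ω := by
        funext t
        exact Set.indicator_of_mem (s := {ω | G ω < ∞}) hω _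
      rw [e]
      have hd := hasDerivAt_tsum_mul_comp_sub ha.le (hK0 0) (hK0 1)
        (summable_of_tsum_enorm_lt_top hω).1 (hK 0) (hK 1) (hasDerivAt_iteratedDeriv hg 0)
      rw [iteratedDeriv_zero] at hd
      exact continuous_iff_continuousAt.mpr fun t => (hd t).continuousAt
    · have e : (fun t => {ω | G ω < ∞}.indicator (shotNoise β τ g t) ω) = fun t => 0 := by
        funext t
        exact Set.indicator_of_notMem (s := {ω | G ω < ∞}) hω _
      rw [e]
      exact continuous_const
  · filter_upwards [ae_lt_top hGm hG.ne] with ω hω t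
    exact (Set.indicator_of_mem (s := {ω | G ω < ∞}) hω _).symm

end Main

end ShotNoise

theorem mainTheorem8 {Ω : Type*} [MeasurableSpace Ω] (P : Measure Ω) [IsProbabilityMeasure P]
    (β τ : ℕ → Ω → ℝ) (l α : ℝ) (g : ℝ → ℝ)
    (hτ : ShotNoise.IsPoissonProcess τ l P)
    (hβ : ShotNoise.IsImpulses β τ P)
    (hβ_int : Integrable (β 0) P)
    (hg : ContDiff ℝ ((⊤ : ℕ∞) : WithTop ℕ∞) g)
    (hg_int : Integrable g volume)
    (hα : 0 < α)
    (hg_exp : ShotNoise.HasExponentialDerivatives g α)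
    (hl : α < l)
    (h : ShotNoise.HasBoundedDensity (β 0) P ∨
      ((∫⁻ ω, ‖β 0 ω‖ₑ⁻¹ ∂P) < ∞ ∧
        ((∀ x : ℝ, 0 < x → deriv g x < 0) ∨
          (∀ x : ℝ, 0 < x → deriv (fun y => g (-y)) x < 0)))) :
    (∀ᵐ ω ∂P, ∀ t : ℝ, Summable fun i => β i ω * g (t - τ i ω)) ∧
    ∀ (I : Set ℝ), I.OrdConnected → Bornology.IsBounded I → ∀ u p : ℝ, 1 ≤ p →
      AEMeasurable
          (fun ω => (ShotNoise.crossings (ShotNoise.shotNoise β τ g) I u ω : ℝ≥0∞)) P ∧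
      (∫⁻ ω, (ShotNoise.crossings (ShotNoise.shotNoise β τ g) I u ω : ℝ≥0∞) ^ p ∂P) < ∞ := by
  have hl0 : 0 < l := hα.trans hl
  -- A law with a density has no atoms, and an atom at zero would make the mean of `1 / |β 0|`
  -- infinite.
  have hβ0 : P.map (β 0) {0} = 0 := h.elim (fun h => h.map_singleton_zero)
    fun h => ShotNoise.map_singleton_zero_of_lintegral_inv (hβ.measurable 0) h.1
  have hdec := hg_exp.exists_abs_iteratedDeriv_le hα hg hg_int
  have ha : 0 < α / 2 := half_pos hα
  have hG : ∫⁻ ω, ∑' i, ‖β i ω‖ₑ * ENNReal.ofReal (Real.exp (-(α / 2) * |τ i ω|)) ∂P < ∞ := by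
    rw [hτ.lintegral_tsum_impulses hβ hl0.le
      (f := fun x => ENNReal.ofReal (Real.exp (-(α / 2) * |x|))) (by fun_prop)]
    refine ENNReal.mul_lt_top hβ_int.2 (ENNReal.mul_lt_top ENNReal.ofReal_lt_top ?_)
    exact (ShotNoise.integrable_exp_neg_mul_abs ha).lintegral_lt_top
  refine ⟨?_, fun I hI hIb u p hp => ?_⟩
  · obtain ⟨K, hK0, hK⟩ := hdec 0
    rw [iteratedDeriv_zero] at hK
    filter_upwards [ae_lt_top' (by have := hβ.measurable; have := hτ.measurable; fun_prop) hG.ne]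
      with ω hω t
    exact ShotNoise.summable_mul_comp_sub ha.le hK0
      (ShotNoise.summable_of_tsum_enorm_lt_top hω).1 hK t
  · obtain ⟨X, hXm, hXc, hX⟩ := ShotNoise.exists_measurable_continuous_eq_shotNoise
      hβ.measurable hτ.measurable hg ha hdec hG
    have hcm := ShotNoise.measurable_crossings hXm hXc hI u
    have hae : ∀ᵐ ω ∂P, ShotNoise.crossings (ShotNoise.shotNoise β τ g) I u ω =
        ShotNoise.crossings X I u ω := by
      filter_upwards [hX] with ω hω
      simp only [ShotNoise.crossings, hω]
    refine ⟨⟨fun ω => (ShotNoise.crossings X I u ω : ℝ≥0∞), by fun_prop, ?_⟩, ?_⟩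
    · filter_upwards [hae] with ω hω
      rw [hω]
    · obtain ⟨T, hT, hIT⟩ := hIb.subset_closedBall_lt 0 0
      rw [Real.closedBall_eq_Icc, zero_sub, zero_add] at hIT
      obtain ⟨C, γ, hC, hγ, hsmall⟩ := ShotNoise.exists_measure_abs_shotNoise_sub_le hτ hβ hl0
        hβ_int hβ0 hg hg_int hα hg_exp
      obtain ⟨k, A, hk, hA, htail⟩ := ShotNoise.exists_measure_lt_crossings_le hβ.measurable
        hτ.measurable hg ha hdec hG hC hγ hsmall hT hIT u (s := p + 2) (by linarith)
      have e : ∫⁻ ω, (ShotNoise.crossings (ShotNoise.shotNoise β τ g) I u ω : ℝ≥0∞) ^ p ∂P =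
          ∫⁻ ω, (ShotNoise.crossings X I u ω : ℝ≥0∞) ^ p ∂P := by
        refine lintegral_congr_ae ?_
        filter_upwards [hae] with ω hω
        rw [hω]
      rw [e]
      refine ShotNoise.lintegral_rpow_lt_top_of_tail_le hcm hk (by linarith) hA fun n hn => ?_
      refine le_trans (le_of_eq (measure_congr ?_)) (htail n hn)
      filter_upwards [hae] with ω hω
      exact propext (by change (_ < _) ↔ (_ < _); rw [hω])
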